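/- Let $k$ be a field containing all primitive roots of unity, that is, containing a primitive $n$-th root of unity for every positive integer $n$ with $n\neq 0$ in $k$. A group datum $\mathbb G=(G,g,\chi,\mu)$ over $k$ consists of a finite group $G$, a central element $g\in G$, a character $\chi:G\to k^\cdot$ with $\chi(g)\neq 1$, and an element $\mu\in k$ such that $\mu=0$ if $o(g)=o(\chi(g))$, and such that $\chi^{o(\chi(g))}=1$ if $\mu\neq 0$. Put $d=o(\chi(g))$. The Hopf algebra $A(\mathbb G)$ is, as an algebra, the quotient of the free product $k[x]*k[G]$ by the two-sided ideal generated by the relations $xh=\chi(h)hx$ for $h\in G$, and $x^d=\mu(1-g^d)$; its Hopf algebra structure is determined by $\Delta(x)=1\otimes x+x\otimes g$, $\varepsilon(x)=0$, $S(x)=-xg^{-1}$, and $\Delta(h)=h\otimes h$, $\varepsilon(h)=1$, $S(h)=h^{-1}$ for $h\in G$. The group datum $\mathbb G$ is of type I if $\mu=0$, $d=o(g)$ and $\chi^d=1$. For a Hopf algebra $A$ over $k$ let $\mathrm{Reg}^1_L(A)$ be the group (under convolution) of the convolution invertible linear maps $\mu:A\to k$ with $\mu(1)=1$ and $\mu(a_1)a_2=\mu(a_2)a_1$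 for all $a\in A$. Let $Z^2_L(A)$ be the group (under convolution) of lazy $2$-cocycles, that is, of the convolution invertible linear maps $\sigma:A\otimes A\to k$ with $\sigma(a,1)=\varepsilon(a)=\sigma(1,a)$, with $\sigma(a_1,b_1)a_2b_2=\sigma(a_2,b_2)a_1b_1$, and with $\sigma(a_1,b_1)\sigma(a_2b_2,c)=\sigma(b_1,c_1)\sigma(a,b_2c_2)$ for all $a,b,c\in A$. The formula $\partial(\mu)(a,b)=\mu(a_1)\mu(b_1)\mu^{-1}(a_2b_2)$ defines a group homomorphism $\partial:\mathrm{Reg}^1_L(A)\to Z^2_L(A)$ with central image $B^2_L(A)$, and the second lazy cohomology group of $A$ is $H^2_L(A)=Z^2_L(A)/B^2_L(A)$. Finally, $H^2(G/\langle g\rangle,k^\cdot)$ denotes the second cohomology group of $G/\langle g\rangle$ with coefficients in the trivial module $k^\cdot$. **Theorem.** Let $\mathbb G=(G,g,\chi,\mu)$ be a group datum over $k$. If $\mathbb G$ is of type I, then there is a group isomorphism $H^2_L(A(\mathbb G))\cong H^2(G/\langle g\rangle,k^\cdot)\times k$, where $k$ is regarded as its additive group. If $\mathbb G$ is not of type I,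 then there is a group isomorphism $H^2_L(A(\mathbb G))\cong H^2(G/\langle g\rangle,k^\cdot)$. -/

import Mathlib

noncomputable section

open scoped TensorProduct

namespace LazyCohomology

open WithConv LinearMap Coalgebra

universe u v w

section Convolution

variable {k : Type u} [CommRing k]
variable {C : Type v} [AddCommGroup C] [Module k C] [Coalgebra k C]
variable {D : Type w} [AddCommGroup D] [Module k D] [Coalgebra k D]

/-- Composition with a coalgebra map `φ : C → D`, as a monoid homomorphism from the convolution
monoid of linear forms on `D` to that of linear forms on `C`. -/
def pullback (φ : C →ₗc[k] D) : WithConv (D →ₗ[k] k) →* WithConv (C →ₗ[k] k) where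
  toFun f := toConv (f.ofConv ∘ₗ φ.toLinearMap)
  map_one' := by
    ext c
    simp [LinearMap.convOne_def]
  map_mul' f g := by
    ext1
    exact convMul_comp_coalgHom_distrib f g φ

theorem pullback_apply (φ : C →ₗc[k] D) (f : WithConv (D →ₗ[k] k)) (c : C) :
    pullback φ f c = f (φ c) := rfl

/-- A linear form `f : C → k` regarded as the linear map `c ↦ f(c) 1` to an algebra `B`; this is a
monoid homomorphism for the convolution products. -/
def scalar (B : Type w) [Ring B] [Algebra k B] :
    WithConv (C →ₗ[k] k) →* WithConv (C →ₗ[k] B) where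
  toFun f := toConv (Algebra.linearMap k B ∘ₗ f.ofConv)
  map_one' := by
    ext c
    simp [LinearMap.convOne_def]
  map_mul' f g := by
    ext1
    exact algHom_comp_convMul_distrib (Algebra.ofId k B) f g

theorem scalar_apply (B : Type w) [Ring B] [Algebra k B] (f : WithConv (C →ₗ[k] k)) (c : C) :
    scalar B f c = algebraMap k B (f c) := rfl

theorem commute_scalar_comp {B : Type w} [Ring B] [Algebra k B]
    {B' : Type*} [Ring B'] [Algebra k B']
    {f : WithConv (C →ₗ[k] k)} {φ : WithConv (C →ₗ[k] B)} (h : Commute (scalar B f) φ)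
    (τ : B →ₗ[k] B') : Commute (scalar B' f) (toConv (τ ∘ₗ φ.ofConv)) := by
  ext c
  have := congr(τ ($(h.eq) c))
  rw [(ℛ k c).convMul_apply, (ℛ k c).convMul_apply] at this ⊢
  simpa [scalar_apply, ← Algebra.smul_def, ← Algebra.commutes] using this

theorem commute_comp {B : Type w} [Ring B] [Algebra k B]
    {f : WithConv (C →ₗ[k] k)} {φ : WithConv (C →ₗ[k] B)} (h : Commute (scalar B f) φ)
    (τ : B →ₗ[k] k) : Commute f (toConv (τ ∘ₗ φ.ofConv)) :=
  commute_scalar_comp h τ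

theorem commute_scalar_pullback {B : Type*} [Ring B] [Algebra k B]
    {f : WithConv (D →ₗ[k] k)} {φ : WithConv (D →ₗ[k] B)} (h : Commute (scalar B f) φ)
    (ψ : C →ₗc[k] D) :
    Commute (scalar B (pullback ψ f)) (toConv (φ.ofConv ∘ₗ ψ.toLinearMap)) := by
  have h1 := convMul_comp_coalgHom_distrib (scalar B f) φ ψ
  have h2 := convMul_comp_coalgHom_distrib φ (scalar B f) ψ
  rw [h.eq] at h1
  exact WithConv.ofConv_injective (h1.symm.trans h2)

end Convolution

section Lazy

variable (k : Type u) [CommRing k] (A : Type v) [Ring A] [HopfAlgebra k A]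

/-- The group of convolution invertible linear forms on `A`. -/
abbrev ConvUnits₁ := (WithConv (A →ₗ[k] k))ˣ

/-- The group of convolution invertible linear forms on `A ⊗ A`. -/
abbrev ConvUnits₂ := (WithConv (A ⊗[k] A →ₗ[k] k))ˣ

/-- The coalgebra map `a ⊗ b ↦ ε(b) a`. -/
def pr₁ : A ⊗[k] A →ₗc[k] A :=
  (Coalgebra.TensorProduct.rid k k A : A ⊗[k] k →ₗc[k] A).comp
    (Coalgebra.TensorProduct.map (CoalgHom.id k A) (counitCoalgHom k A))

/-- The coalgebra map `a ⊗ b ↦ ε(a) b`. -/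
def pr₂ : A ⊗[k] A →ₗc[k] A :=
  (Coalgebra.TensorProduct.lid k A : k ⊗[k] A →ₗc[k] A).comp
    (Coalgebra.TensorProduct.map (counitCoalgHom k A) (CoalgHom.id k A))

/-- The coalgebra map `a ⊗ b ⊗ c ↦ ε(c) a ⊗ b`. -/
def pr₁₂ : (A ⊗[k] A) ⊗[k] A →ₗc[k] A ⊗[k] A :=
  (Coalgebra.TensorProduct.rid k k (A ⊗[k] A) : (A ⊗[k] A) ⊗[k] k →ₗc[k] A ⊗[k] A).comp
    (Coalgebra.TensorProduct.map (CoalgHom.id k (A ⊗[k] A)) (counitCoalgHom k A))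

/-- The coalgebra map `a ⊗ b ⊗ c ↦ ε(a) b ⊗ c`. -/
def pr₂₃ : (A ⊗[k] A) ⊗[k] A →ₗc[k] A ⊗[k] A :=
  Coalgebra.TensorProduct.map (pr₂ k A) (CoalgHom.id k A)

/-- The coalgebra map `a ⊗ b ⊗ c ↦ ab ⊗ c`. -/
def mul₁₂ : (A ⊗[k] A) ⊗[k] A →ₗc[k] A ⊗[k] A :=
  Coalgebra.TensorProduct.map (Bialgebra.mulCoalgHom k A) (CoalgHom.id k A)

/-- The coalgebra map `a ⊗ b ⊗ c ↦ a ⊗ bc`. -/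
def mul₂₃ : (A ⊗[k] A) ⊗[k] A →ₗc[k] A ⊗[k] A :=
  (Coalgebra.TensorProduct.map (CoalgHom.id k A) (Bialgebra.mulCoalgHom k A)).comp
    (Coalgebra.TensorProduct.assoc k k A A A : (A ⊗[k] A) ⊗[k] A →ₗc[k] A ⊗[k] (A ⊗[k] A))

variable {k A}

@[simp] theorem pr₁_tmul (a b : A) : pr₁ k A (a ⊗ₜ b) = counit (R := k) b • a := rfl

@[simp] theorem pr₂_tmul (a b : A) : pr₂ k A (a ⊗ₜ b) = counit (R := k) a • b := rfl

@[simp] theorem pr₁₂_tmul (a b c : A) :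
    pr₁₂ k A ((a ⊗ₜ b) ⊗ₜ c) = counit (R := k) c • (a ⊗ₜ[k] b) := rfl

@[simp] theorem pr₂₃_tmul (a b c : A) :
    pr₂₃ k A ((a ⊗ₜ b) ⊗ₜ c) = (counit (R := k) a • b) ⊗ₜ[k] c := rfl

@[simp] theorem mul₁₂_tmul (a b c : A) :
    mul₁₂ k A ((a ⊗ₜ b) ⊗ₜ c) = (a * b) ⊗ₜ[k] c := rfl

@[simp] theorem mul₂₃_tmul (a b c : A) :
    mul₂₃ k A ((a ⊗ₜ b) ⊗ₜ c) = a ⊗ₜ[k] (b * c) := rfl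

/-- Normalization: `σ(a, 1) = ε(a) = σ(1, a)`. -/
def IsNormalized (σ : WithConv (A ⊗[k] A →ₗ[k] k)) : Prop :=
  ∀ a : A, σ (a ⊗ₜ 1) = counit (R := k) a ∧ σ (1 ⊗ₜ a) = counit (R := k) a

/-- Laziness in degree one: `μ * id = id * μ`, i.e. `μ(a₁) a₂ = a₁ μ(a₂)`. -/
def IsLazy₁ (μ : WithConv (A →ₗ[k] k)) : Prop :=
  scalar A μ * toConv LinearMap.id = toConv LinearMap.id * scalar A μ

/-- Laziness in degree two: `σ * m = m * σ` for the multiplication `m : A ⊗ A → A`, i.e.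
`σ(a₁, b₁) a₂ b₂ = a₁ b₁ σ(a₂, b₂)`. -/
def IsLazy₂ (σ : WithConv (A ⊗[k] A →ₗ[k] k)) : Prop :=
  scalar A σ * toConv (LinearMap.mul' k A) = toConv (LinearMap.mul' k A) * scalar A σ

/-- The left cocycle condition `σ(a₁, b₁) σ(a₂ b₂, c) = σ(b₁, c₁) σ(a, b₂ c₂)`, as an equality of
convolution products of linear forms on `A ⊗ A ⊗ A`. -/
def IsLeftCocycle (σ : WithConv (A ⊗[k] A →ₗ[k] k)) : Prop :=
  pullback (pr₁₂ k A) σ * pullback (mul₁₂ k A) σ =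
    pullback (pr₂₃ k A) σ * pullback (mul₂₃ k A) σ

theorem scalar_tensor {B B' : Type*} [Ring B] [Ring B'] [Algebra k B] [Algebra k B']
    {C : Type*} [AddCommGroup C] [Module k C] [Coalgebra k C]
    {D : Type*} [AddCommGroup D] [Module k D] [Coalgebra k D]
    {f : WithConv (C →ₗ[k] k)} {φ : WithConv (C →ₗ[k] B)} (h : Commute (scalar B f) φ)
    (φ' : WithConv (D →ₗ[k] B')) (F : WithConv (C ⊗[k] D →ₗ[k] k))
    (hF : ∀ c d, F (c ⊗ₜ d) = f c * counit (R := k) d) :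
    Commute (scalar (B ⊗[k] B') F) (toConv (TensorProduct.map φ.ofConv φ'.ofConv)) := by
  have : scalar (B ⊗[k] B') F =
      toConv (TensorProduct.map (scalar B f).ofConv (1 : WithConv (D →ₗ[k] B')).ofConv) := by
    ext c d
    simp [hF, LinearMap.convOne_def, Algebra.algebraMap_eq_smul_one,
      TensorProduct.smul_tmul', TensorProduct.tmul_smul, smul_smul,
      Algebra.TensorProduct.one_def, scalar, mul_comm]
  unfold Commute SemiconjBy
  rw [this, TensorProduct.map_convMul_map, TensorProduct.map_convMul_map, h.eq, one_mul, mul_one]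

theorem scalar_tensor' {B B' : Type*} [Ring B] [Ring B'] [Algebra k B] [Algebra k B']
    {C : Type*} [AddCommGroup C] [Module k C] [Coalgebra k C]
    {D : Type*} [AddCommGroup D] [Module k D] [Coalgebra k D]
    {f : WithConv (D →ₗ[k] k)} {φ' : WithConv (D →ₗ[k] B')} (h : Commute (scalar B' f) φ')
    (φ : WithConv (C →ₗ[k] B)) (F : WithConv (C ⊗[k] D →ₗ[k] k))
    (hF : ∀ c d, F (c ⊗ₜ d) = counit (R := k) c * f d) :
    Commute (scalar (B ⊗[k] B') F) (toConv (TensorProduct.map φ.ofConv φ'.ofConv)) := by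
  have : scalar (B ⊗[k] B') F =
      toConv (TensorProduct.map (1 : WithConv (C →ₗ[k] B)).ofConv (scalar B' f).ofConv) := by
    ext c d
    simp [hF, LinearMap.convOne_def, Algebra.algebraMap_eq_smul_one,
      TensorProduct.smul_tmul', TensorProduct.tmul_smul, smul_smul,
      Algebra.TensorProduct.one_def, scalar, mul_comm]
  unfold Commute SemiconjBy
  rw [this, TensorProduct.map_convMul_map, TensorProduct.map_convMul_map, h.eq, one_mul, mul_one]

theorem IsLazy₁.commute {μ : WithConv (A →ₗ[k] k)} (hμ : IsLazy₁ μ)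
    (ν : WithConv (A →ₗ[k] k)) : Commute μ ν := by
  have h : Commute (scalar A μ) (toConv LinearMap.id) := hμ
  have h' := commute_comp h ν.ofConv
  rwa [WithConv.ofConv_toConv, LinearMap.comp_id, WithConv.toConv_ofConv] at h'

theorem IsLazy₁.scalar_pr₁ {μ : WithConv (A →ₗ[k] k)} (hμ : IsLazy₁ μ) :
    Commute (scalar (A ⊗[k] A) (pullback (pr₁ k A) μ)) (toConv LinearMap.id) := by
  have h : Commute (scalar A μ) (toConv LinearMap.id) := hμ
  have := scalar_tensor h (toConv (LinearMap.id : A →ₗ[k] A))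
    (pullback (pr₁ k A) μ) (fun c d => by simp [pullback_apply, mul_comm])
  rwa [WithConv.ofConv_toConv, TensorProduct.map_id] at this

theorem IsLazy₁.scalar_pr₂ {μ : WithConv (A →ₗ[k] k)} (hμ : IsLazy₁ μ) :
    Commute (scalar (A ⊗[k] A) (pullback (pr₂ k A) μ)) (toConv LinearMap.id) := by
  have h : Commute (scalar A μ) (toConv LinearMap.id) := hμ
  have := scalar_tensor' h (toConv (LinearMap.id : A →ₗ[k] A))
    (pullback (pr₂ k A) μ) (fun c d => by simp [pullback_apply])
  rwa [WithConv.ofConv_toConv, TensorProduct.map_id] at this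

theorem IsLazy₁.commute_pr₁ {μ : WithConv (A →ₗ[k] k)} (hμ : IsLazy₁ μ)
    (τ : WithConv (A ⊗[k] A →ₗ[k] k)) :
    Commute (pullback (pr₁ k A) μ) τ := by
  have h := commute_comp hμ.scalar_pr₁ τ.ofConv
  rwa [WithConv.ofConv_toConv, LinearMap.comp_id, WithConv.toConv_ofConv] at h

theorem IsLazy₁.commute_pr₂ {μ : WithConv (A →ₗ[k] k)} (hμ : IsLazy₁ μ)
    (τ : WithConv (A ⊗[k] A →ₗ[k] k)) :
    Commute (pullback (pr₂ k A) μ) τ := by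
  have h := commute_comp hμ.scalar_pr₂ τ.ofConv
  rwa [WithConv.ofConv_toConv, LinearMap.comp_id, WithConv.toConv_ofConv] at h

theorem IsLazy₁.isLazy_pr₁ {μ : WithConv (A →ₗ[k] k)} (hμ : IsLazy₁ μ) :
    IsLazy₂ (pullback (pr₁ k A) μ) := by
  have h := commute_scalar_comp hμ.scalar_pr₁ (LinearMap.mul' k A)
  rw [WithConv.ofConv_toConv, LinearMap.comp_id] at h
  exact h.eq

theorem IsLazy₁.isLazy_pr₂ {μ : WithConv (A →ₗ[k] k)} (hμ : IsLazy₁ μ) :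
    IsLazy₂ (pullback (pr₂ k A) μ) := by
  have h := commute_scalar_comp hμ.scalar_pr₂ (LinearMap.mul' k A)
  rw [WithConv.ofConv_toConv, LinearMap.comp_id] at h
  exact h.eq

theorem IsLazy₁.isLazy_mul {μ : WithConv (A →ₗ[k] k)} (hμ : IsLazy₁ μ) :
    IsLazy₂ (pullback (Bialgebra.mulCoalgHom k A) μ) := by
  have h : Commute (scalar A μ) (toConv LinearMap.id) := hμ
  have h' := commute_scalar_pullback h (Bialgebra.mulCoalgHom k A)
  rw [WithConv.ofConv_toConv, LinearMap.id_comp] at h'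
  exact h'.eq

theorem IsLazy₂.commute_mul {σ : WithConv (A ⊗[k] A →ₗ[k] k)} (hσ : IsLazy₂ σ)
    (τ : WithConv (A →ₗ[k] k)) :
    Commute σ (pullback (Bialgebra.mulCoalgHom k A) τ) :=
  commute_comp hσ τ.ofConv

theorem IsLazy₂.commute_mul₁₂ {σ : WithConv (A ⊗[k] A →ₗ[k] k)} (hσ : IsLazy₂ σ)
    (τ : WithConv (A ⊗[k] A →ₗ[k] k)) :
    Commute (pullback (pr₁₂ k A) σ) (pullback (mul₁₂ k A) τ) :=
  commute_comp (scalar_tensor hσ (toConv (LinearMap.id : A →ₗ[k] A))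
    (pullback (pr₁₂ k A) σ) (fun c d => by
      induction c with
      | zero => simp
      | add x y hx hy => rw [TensorProduct.add_tmul, map_add, hx, hy, map_add, add_mul]
      | tmul a b => simp [pullback_apply, mul_comm])) τ.ofConv

theorem IsLazy₂.commute_mul₂₃ {σ : WithConv (A ⊗[k] A →ₗ[k] k)} (hσ : IsLazy₂ σ)
    (τ : WithConv (A ⊗[k] A →ₗ[k] k)) :
    Commute (pullback (pr₂₃ k A) σ) (pullback (mul₂₃ k A) τ) := by
  let F : WithConv (A ⊗[k] (A ⊗[k] A) →ₗ[k] k) := pullback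
    ((Coalgebra.TensorProduct.lid k (A ⊗[k] A) : k ⊗[k] (A ⊗[k] A) →ₗc[k] A ⊗[k] A).comp
    (Coalgebra.TensorProduct.map (counitCoalgHom k A) (CoalgHom.id k (A ⊗[k] A)))) σ
  have h := scalar_tensor' (C := A) hσ (toConv (LinearMap.id : A →ₗ[k] A)) F (fun c d => by
      change σ.ofConv (counit (R := k) c • d) = _
      simp)
  have h' := commute_scalar_pullback h
    (Coalgebra.TensorProduct.assoc k k A A A : (A ⊗[k] A) ⊗[k] A →ₗc[k] A ⊗[k] (A ⊗[k] A))
  have e : pullback (pr₂₃ k A) σ = pullback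
      (Coalgebra.TensorProduct.assoc k k A A A : (A ⊗[k] A) ⊗[k] A →ₗc[k] A ⊗[k] (A ⊗[k] A)) F := by
    ext a b c
    simp [pullback, F, TensorProduct.smul_tmul']
  rw [e]
  exact commute_comp h' τ.ofConv

/-! ### The groups -/

variable (k A) in
/-- The coalgebra map `a ↦ a ⊗ 1`. -/
def inl : A →ₗc[k] A ⊗[k] A :=
  (Coalgebra.TensorProduct.map (CoalgHom.id k A)
    (Bialgebra.unitBialgHom k A : k →ₗc[k] A)).comp
    ((Coalgebra.TensorProduct.rid k k A).symm : A →ₗc[k] A ⊗[k] k)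

variable (k A) in
/-- The coalgebra map `a ↦ 1 ⊗ a`. -/
def inr : A →ₗc[k] A ⊗[k] A :=
  (Coalgebra.TensorProduct.map (Bialgebra.unitBialgHom k A : k →ₗc[k] A)
    (CoalgHom.id k A)).comp
    ((Coalgebra.TensorProduct.lid k A).symm : A →ₗc[k] k ⊗[k] A)

@[simp] theorem inl_apply (a : A) : inl k A a = a ⊗ₜ[k] 1 := by
  change a ⊗ₜ[k] (algebraMap k A 1) = _
  rw [map_one]

@[simp] theorem inr_apply (a : A) : inr k A a = 1 ⊗ₜ[k] a := by
  change (algebraMap k A 1) ⊗ₜ[k] a = _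
  rw [map_one]

theorem isNormalized_iff (σ : WithConv (A ⊗[k] A →ₗ[k] k)) :
    IsNormalized σ ↔ pullback (inl k A) σ = 1 ∧ pullback (inr k A) σ = 1 := by
  constructor
  · intro h
    constructor
    · ext a
      simpa [pullback] using (h a).1
    · ext a
      simpa [pullback] using (h a).2
  · rintro ⟨h1, h2⟩ a
    constructor
    · simpa [pullback] using congr($h1 a)
    · simpa [pullback] using congr($h2 a)

variable (k A) in
/-- The group `Reg¹_L(A)` of lazy convolution invertible linear forms `μ` with `μ(1) = 1`. -/
def Reg₁L : Subgroup (ConvUnits₁ k A) where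
  carrier := {μ | μ.val 1 = 1 ∧ IsLazy₁ μ.val}
  one_mem' := by
    refine ⟨by simp, ?_⟩
    simp [IsLazy₁]
  mul_mem' := by
    rintro μ ν ⟨h1, h2⟩ ⟨h3, h4⟩
    refine ⟨?_, ?_⟩
    · simp only [Units.val_mul, LinearMap.convMul_apply, Bialgebra.comul_one,
        Algebra.TensorProduct.one_def]
      simp [h1, h3]
    · have e2 : Commute _ _ := h2
      have e4 : Commute _ _ := h4
      have := (e2.mul_left e4).eq
      rwa [← map_mul] at this
  inv_mem' := by
    rintro μ ⟨h1, h2⟩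
    refine ⟨?_, ?_⟩
    · have := congr($(μ.mul_inv) 1)
      simp only [LinearMap.convMul_apply, Bialgebra.comul_one,
        Algebra.TensorProduct.one_def] at this
      simpa [h1] using this
    · have e2 : Commute (Units.map (scalar A) μ).val _ := h2
      exact e2.units_inv_left

variable (k A) in
/-- The group `Z²_L(A)` of lazy two-cocycles: the convolution invertible normalized linear forms
on `A ⊗ A` that are lazy left two-cocycles. -/
def Z₂L : Subgroup (ConvUnits₂ k A) where
  carrier := {σ | IsNormalized σ.val ∧ IsLazy₂ σ.val ∧ IsLeftCocycle σ.val}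
  one_mem' := by
    refine ⟨(isNormalized_iff _).2 (by simp), ?_, ?_⟩
    · simp [IsLazy₂]
    · simp [IsLeftCocycle]
  mul_mem' := by
    rintro σ ω ⟨h1, h2, h3⟩ ⟨h4, h5, h6⟩
    refine ⟨?_, ?_, ?_⟩
    · rw [isNormalized_iff] at *
      simp [h1, h4]
    · have e2 : Commute _ _ := h2
      have e5 : Commute _ _ := h5
      have := (e2.mul_left e5).eq
      rwa [← map_mul] at this
    · unfold IsLeftCocycle at *
      rw [Units.val_mul, map_mul, map_mul, map_mul, map_mul,
        (h5.commute_mul₁₂ _).mul_mul_mul_comm, h3, h6,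
        (h5.commute_mul₂₃ _).symm.mul_mul_mul_comm]
  inv_mem' := by
    rintro σ ⟨h1, h2, h3⟩
    refine ⟨?_, ?_, ?_⟩
    · rw [isNormalized_iff] at *
      constructor
      · have : Units.map (pullback (inl k A)) σ = 1 := Units.ext h1.1
        have := congr(($this)⁻¹.val)
        rw [inv_one] at this
        exact this
      · have : Units.map (pullback (inr k A)) σ = 1 := Units.ext h1.2
        have := congr(($this)⁻¹.val)
        rw [inv_one] at this
        exact this
    · have e2 : Commute (Units.map (scalar A) σ).val _ := h2
      exact e2.units_inv_left
    · have e : Units.map (pullback (mul₁₂ k A)) σ * Units.map (pullback (pr₁₂ k A)) σ =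
          Units.map (pullback (mul₂₃ k A)) σ * Units.map (pullback (pr₂₃ k A)) σ := by
        ext1
        exact (h2.commute_mul₁₂ _).symm.eq.trans (h3.trans (h2.commute_mul₂₃ _).eq)
      have := congr(($e)⁻¹.val)
      rw [mul_inv_rev, mul_inv_rev] at this
      exact this

/-- The differential `∂(μ)(a, b) = μ(a₁) μ(b₁) μ⁻¹(a₂ b₂)`. -/
def diff (μ : ConvUnits₁ k A) : ConvUnits₂ k A :=
  Units.map (pullback (pr₁ k A)) μ * Units.map (pullback (pr₂ k A)) μ *
    (Units.map (pullback (Bialgebra.mulCoalgHom k A)) μ)⁻¹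

theorem commute_units {M : Type*} [Monoid M] {x y : Mˣ} (h : Commute x.val y.val) : Commute x y :=
  Units.ext h.eq

theorem diff_mul {μ ν : ConvUnits₁ k A} (hμ : IsLazy₁ μ.val) (hν : IsLazy₁ ν.val) :
    diff (μ * ν) = diff μ * diff ν := by
  have c1 : ∀ τ, Commute (Units.map (pullback (pr₁ k A)) ν) τ :=
    fun τ => commute_units (hν.commute_pr₁ _)
  have c2 : ∀ τ, Commute (Units.map (pullback (pr₂ k A)) ν) τ :=
    fun τ => commute_units (hν.commute_pr₂ _)
  have c3 : Commute (Units.map (pullback (Bialgebra.mulCoalgHom k A)) μ)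
      (Units.map (pullback (Bialgebra.mulCoalgHom k A)) ν) :=
    Commute.map (commute_units (hμ.commute _)) (Units.map _)
  unfold diff
  simp only [map_mul]
  rw [(c1 _).mul_mul_mul_comm, mul_inv_rev, c3.symm.inv_inv.eq, ((c1 _).mul_left (c2 _)).mul_mul_mul_comm]

variable (k A) in
/-- The differential on lazy forms, as a group homomorphism. -/
def diffHom : Reg₁L k A →* ConvUnits₂ k A :=
  MonoidHom.mk' (fun μ => diff μ.val) (fun μ ν => diff_mul μ.2.2 ν.2.2)

variable (k A) in
/-- The group `B²_L(A) = ∂(Reg¹_L(A))`. -/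
def B₂L : Subgroup (ConvUnits₂ k A) := (diffHom k A).range

theorem mem_B₂L {σ : ConvUnits₂ k A} : σ ∈ B₂L k A ↔ ∃ μ ∈ Reg₁L k A, diff μ = σ :=
  ⟨fun ⟨μ, h⟩ => ⟨μ.1, μ.2, h⟩, fun ⟨μ, hμ, h⟩ => ⟨⟨μ, hμ⟩, h⟩⟩

theorem diff_aux {M : Type*} [Group M] {x1 x2 x3 x12 x23 x123 y1 y2 y3 y12 y23 y123 : M}
    (e1 : y1 = x1) (e2 : y2 = x2) (e3 : y3 = x3) (e12 : y12 = x12) (e23 : y23 = x23)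
    (e123 : y123 = x123) (c2 : Commute x1 y2) (c3 : Commute x1 y3) (c23 : Commute y1 y23) :
    x1 * y2 * x12⁻¹ * (y12 * y3 * y123⁻¹) = x2 * x3 * x23⁻¹ * (y1 * y23 * x123⁻¹) := by
  subst e1 e2 e3 e12 e23 e123
  have l : y1 * y2 * y12⁻¹ * (y12 * y3 * y123⁻¹) = y1 * (y2 * y3) * y123⁻¹ := by group
  rw [l, c23.eq, (c2.mul_right c3).eq]
  group

theorem isLeftCocycle_diff {μ : ConvUnits₁ k A} (h2 : IsLazy₁ μ.val) :
    IsLeftCocycle (diff μ).val := by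
  have e : Units.map (pullback (pr₁₂ k A)) (diff μ) * Units.map (pullback (mul₁₂ k A)) (diff μ) =
      Units.map (pullback (pr₂₃ k A)) (diff μ) * Units.map (pullback (mul₂₃ k A)) (diff μ) := by
    have c1 : ∀ τ : ConvUnits₂ k A, Commute (Units.map (pullback (pr₁ k A)) μ) τ :=
      fun τ => commute_units (h2.commute_pr₁ τ.val)
    have e12 : Units.map (pullback (mul₁₂ k A)) (Units.map (pullback (pr₁ k A)) μ) =
        Units.map (pullback (pr₁₂ k A))
        (Units.map (pullback (Bialgebra.mulCoalgHom k A)) μ) := by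
      ext a b c; simp [pullback]
    have e3 : Units.map (pullback (mul₁₂ k A)) (Units.map (pullback (pr₂ k A)) μ) =
        Units.map (pullback (pr₂₃ k A)) (Units.map (pullback (pr₂ k A)) μ) := by
      ext a b c; simp [pullback]
    have e123 : Units.map (pullback (mul₁₂ k A))
        (Units.map (pullback (Bialgebra.mulCoalgHom k A)) μ) =
        Units.map (pullback (mul₂₃ k A))
        (Units.map (pullback (Bialgebra.mulCoalgHom k A)) μ) := by
      ext a b c; simp [pullback, mul_assoc]
    have e2 : Units.map (pullback (pr₁₂ k A)) (Units.map (pullback (pr₂ k A)) μ) =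
        Units.map (pullback (pr₂₃ k A)) (Units.map (pullback (pr₁ k A)) μ) := by
      ext a b c; simp [pullback]
    have e1 : Units.map (pullback (mul₂₃ k A)) (Units.map (pullback (pr₁ k A)) μ) =
        Units.map (pullback (pr₁₂ k A)) (Units.map (pullback (pr₁ k A)) μ) := by
      ext a b c; simp [pullback]; ring
    have e23 : Units.map (pullback (mul₂₃ k A)) (Units.map (pullback (pr₂ k A)) μ) =
        Units.map (pullback (pr₂₃ k A))
        (Units.map (pullback (Bialgebra.mulCoalgHom k A)) μ) := by
      ext a b c; simp [pullback]
    have c2 : Commute (Units.map (pullback (pr₁₂ k A)) (Units.map (pullback (pr₁ k A)) μ))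
        (Units.map (pullback (pr₁₂ k A)) (Units.map (pullback (pr₂ k A)) μ)) :=
      (c1 _).map (Units.map (pullback (pr₁₂ k A)))
    have c3 : Commute (Units.map (pullback (pr₁₂ k A)) (Units.map (pullback (pr₁ k A)) μ))
        (Units.map (pullback (mul₁₂ k A)) (Units.map (pullback (pr₂ k A)) μ)) :=
      commute_units (h2.isLazy_pr₁.commute_mul₁₂ _)
    have c23 : Commute (Units.map (pullback (mul₂₃ k A)) (Units.map (pullback (pr₁ k A)) μ))
        (Units.map (pullback (mul₂₃ k A)) (Units.map (pullback (pr₂ k A)) μ)) :=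
      (c1 _).map (Units.map (pullback (mul₂₃ k A)))
    simp only [diff, map_mul, map_inv]
    exact diff_aux e1 e2 e3 e12 e23 e123 c2 c3 c23
  exact congr(($e).val)

theorem B₂L_le_Z₂L : B₂L k A ≤ Z₂L k A := by
  rintro _ ⟨⟨μ, h1, h2⟩, rfl⟩
  change diff μ ∈ Z₂L k A
  have ev : ∀ c : k, μ.val.ofConv (c • (1 : A)) = c := fun c => by rw [map_smul, h1]; simp
  refine ⟨(isNormalized_iff _).2 ⟨?_, ?_⟩, ?_, ?_⟩
  · have e : Units.map (pullback (inl k A)) (diff μ) = 1 := by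
      have e1 : Units.map (pullback (inl k A)) (Units.map (pullback (pr₁ k A)) μ) = μ := by
        ext a; simp [pullback]
      have e2 : Units.map (pullback (inl k A)) (Units.map (pullback (pr₂ k A)) μ) = 1 := by
        ext a; simp [pullback, h1]
      have e3 : Units.map (pullback (inl k A))
          (Units.map (pullback (Bialgebra.mulCoalgHom k A)) μ) = μ := by
        ext a; simp [pullback]
      rw [diff, map_mul, map_mul, map_inv, e1, e2, e3, mul_one, mul_inv_cancel]
    exact congr(($e).val)
  · have e : Units.map (pullback (inr k A)) (diff μ) = 1 := by
      have e1 : Units.map (pullback (inr k A)) (Units.map (pullback (pr₁ k A)) μ) = 1 := by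
        ext a; simp [pullback, h1]
      have e2 : Units.map (pullback (inr k A)) (Units.map (pullback (pr₂ k A)) μ) = μ := by
        ext a; simp [pullback]
      have e3 : Units.map (pullback (inr k A))
          (Units.map (pullback (Bialgebra.mulCoalgHom k A)) μ) = μ := by
        ext a; simp [pullback]
      rw [diff, map_mul, map_mul, map_inv, e1, e2, e3, one_mul, mul_inv_cancel]
    exact congr(($e).val)
  · have a1 : Commute _ _ := h2.isLazy_pr₁
    have a2 : Commute _ _ := h2.isLazy_pr₂
    have a3 : Commute (Units.map (scalar A)
      (Units.map (pullback (Bialgebra.mulCoalgHom k A)) μ)).val _ := h2.isLazy_mul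
    have a : Commute (Units.map (scalar A) (diff μ)).val (toConv (LinearMap.mul' k A)) := by
      rw [diff, map_mul, map_mul, map_inv]
      exact (Commute.mul_left a1 a2).mul_left a3.units_inv_left
    exact a.eq
  · exact isLeftCocycle_diff h2

theorem commute_of_mem {β σ : ConvUnits₂ k A} (hβ : β ∈ B₂L k A) (hσ : σ ∈ Z₂L k A) :
    Commute β σ := by
  obtain ⟨⟨μ, h1, h2⟩, rfl⟩ := hβ
  have a1 : Commute (Units.map (pullback (pr₁ k A)) μ) σ := commute_units (h2.commute_pr₁ _)
  have a2 : Commute (Units.map (pullback (pr₂ k A)) μ) σ := commute_units (h2.commute_pr₂ _)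
  have a3 : Commute (Units.map (pullback (Bialgebra.mulCoalgHom k A)) μ) σ :=
    commute_units (hσ.2.1.commute_mul _).symm
  exact (a1.mul_left a2).mul_left a3.inv_left

instance : ((B₂L k A).subgroupOf (Z₂L k A)).Normal where
  conj_mem β hβ σ := by
    have c : Commute β σ := Subtype.ext (commute_of_mem hβ σ.2).eq
    rwa [← c.eq, mul_inv_cancel_right]

variable (k A) in
/-- The second lazy cohomology group `H²_L(A) = Z²_L(A) / B²_L(A)`. -/
abbrev H₂L : Type _ := Z₂L k A ⧸ (B₂L k A).subgroupOf (Z₂L k A)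

end Lazy

/-! ### Second group cohomology with trivial coefficients -/

section GroupCohomology

variable (Q : Type v) [Group Q] (M : Type u) [CommGroup M]

/-- The group `Z²(Q, M)` of two-cocycles of `Q` with values in the trivial module `M`, written
multiplicatively. -/
def groupZ₂ : Subgroup (Q → Q → M) where
  carrier := {σ | ∀ g h l : Q, σ g h * σ (g * h) l = σ h l * σ g (h * l)}
  one_mem' := fun _ _ _ => rfl
  mul_mem' := fun {σ τ} hσ hτ g h l => by
    simp only [Pi.mul_apply]
    rw [mul_mul_mul_comm, hσ, hτ, mul_mul_mul_comm]
  inv_mem' := fun {σ} hσ g h l => by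
    simp only [Pi.inv_apply]
    rw [← mul_inv, hσ, mul_inv]

/-- The coboundary `∂(μ)(g, h) = μ(g) μ(h) μ(gh)⁻¹`, as a group homomorphism. -/
def groupDiff : (Q → M) →* (Q → Q → M) where
  toFun μ g h := μ g * μ h * (μ (g * h))⁻¹
  map_one' := by
    ext
    simp
  map_mul' μ ν := by
    ext g h
    simp only [Pi.mul_apply, mul_inv]
    rw [mul_mul_mul_comm (μ g), mul_mul_mul_comm (μ g * μ h)]

/-- The group `B²(Q, M)` of two-coboundaries. -/
def groupB₂ : Subgroup (Q → Q → M) := (groupDiff Q M).range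

/-- The second cohomology group `H²(Q, M) = Z²(Q, M) / B²(Q, M)` of the group `Q` with values in
the trivial module `M`. -/
abbrev groupH₂ : Type _ := groupZ₂ Q M ⧸ (groupB₂ Q M).subgroupOf (groupZ₂ Q M)

end GroupCohomology

end LazyCohomology

/-! ### Group data and their Hopf algebras -/

section GroupDatum

universe u v

/-- A group datum `(G, g, χ, μ)` over `k` on the finite group `G`. -/
structure GroupDatum (k : Type u) [Field k] (G : Type v) [Group G] [Finite G] where
  /-- the central element -/
  g : G
  /-- the character -/
  χ : G →* kˣ
  /-- the scalar -/
  μ : k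
  g_mem_center : g ∈ Subgroup.center G
  χ_g_ne_one : χ g ≠ 1
  μ_eq_zero : orderOf g = orderOf (χ g) → μ = 0
  χ_pow : μ ≠ 0 → χ ^ orderOf (χ g) = 1

namespace GroupDatum

variable {k : Type u} [Field k] {G : Type v} [Group G] [Finite G]

/-- Generators of the algebra `A(𝔾)`: the letter `x` and the elements of the group. -/
inductive Gen (G : Type v) : Type v
  /-- the letter `x` -/
  | x : Gen G
  /-- the element `h` of the group -/
  | grp (h : G) : Gen G

variable (𝔾 : GroupDatum k G)

/-- The number `d`, the order of `χ(g)`. -/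
def d : ℕ := orderOf (𝔾.χ 𝔾.g)

/-- A group datum is of type I if `μ = 0`, `d = o(χ(g)) = o(g)` and `χ ^ d = 1`. -/
def IsTypeI : Prop := 𝔾.μ = 0 ∧ 𝔾.d = orderOf 𝔾.g ∧ 𝔾.χ ^ 𝔾.d = 1

open FreeAlgebra in
/-- The defining relations of `A(𝔾)`: those of the group algebra of `G`, the relations
`x h = χ(h) h x` for `h ∈ G`, and `x ^ d = μ (1 - g ^ d)`. -/
inductive Rel : FreeAlgebra k (Gen G) → FreeAlgebra k (Gen G) → Prop
  | one : Rel (ι k (.grp 1)) 1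
  | mul (h l : G) : Rel (ι k (.grp h) * ι k (.grp l)) (ι k (.grp (h * l)))
  | comm (h : G) :
      Rel (ι k .x * ι k (.grp h)) ((𝔾.χ h : k) • (ι k (.grp h) * ι k .x))
  | pow : Rel (ι k .x ^ 𝔾.d) (𝔾.μ • (1 - ι k (.grp (𝔾.g ^ 𝔾.d))))

/-- The algebra `A(𝔾)`, presented by the generators `x` and `h ∈ G` and the relations above; in
other words the quotient of the free product of `k[x]` and `k[G]` by the ideal generated by
`x h - χ(h) h x` for `h ∈ G` and `x ^ d - μ (1 - g ^ d)`. -/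
def A : Type (max u v) := RingQuot (Rel 𝔾)

instance : Ring 𝔾.A := inferInstanceAs (Ring (RingQuot (Rel 𝔾)))

instance : Algebra k 𝔾.A := inferInstanceAs (Algebra k (RingQuot (Rel 𝔾)))

/-- The generator `x` of `A(𝔾)`. -/
def x : 𝔾.A := RingQuot.mkAlgHom k (Rel 𝔾) (FreeAlgebra.ι k .x)

/-- The image of `h ∈ G` in `A(𝔾)`. -/
def of : G →* 𝔾.A where
  toFun h := RingQuot.mkAlgHom k (Rel 𝔾) (FreeAlgebra.ι k (.grp h))
  map_one' := (RingQuot.mkAlgHom_rel k Rel.one).trans (map_one _)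
  map_mul' h l := (RingQuot.mkAlgHom_rel k (Rel.mul h l)).symm.trans (map_mul _ _ _)

theorem x_mul_of (h : G) : 𝔾.x * 𝔾.of h = (𝔾.χ h : k) • (𝔾.of h * 𝔾.x) := by
  have := RingQuot.mkAlgHom_rel k (Rel.comm (𝔾 := 𝔾) h)
  rwa [map_mul, map_smul, map_mul] at this

theorem x_pow : 𝔾.x ^ 𝔾.d = 𝔾.μ • (1 - 𝔾.of (𝔾.g ^ 𝔾.d)) := by
  have := RingQuot.mkAlgHom_rel k (Rel.pow (𝔾 := 𝔾))
  rwa [map_pow, map_smul, map_sub, map_one] at this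

section Lift

variable {𝔾} {B : Type*} [Ring B] [Algebra k B]

/-- The universal property of `A(𝔾)`. -/
def lift (y : B) (φ : G →* B) (h1 : ∀ h, y * φ h = (𝔾.χ h : k) • (φ h * y))
    (h2 : y ^ 𝔾.d = 𝔾.μ • (1 - φ (𝔾.g ^ 𝔾.d))) : 𝔾.A →ₐ[k] B :=
  RingQuot.liftAlgHom k ⟨FreeAlgebra.lift k (fun | .x => y | .grp h => φ h), by
    intro a b hab
    cases hab with
    | one => simp
    | mul h l => simp
    | comm h => simpa using h1 h
    | pow => simpa using h2⟩

@[simp] theorem lift_x (y : B) (φ : G →* B) (h1 h2) : lift (𝔾 := 𝔾) y φ h1 h2 𝔾.x = y := by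
  unfold lift x
  erw [RingQuot.liftAlgHom_mkAlgHom_apply]
  simp

@[simp] theorem lift_of (y : B) (φ : G →* B) (h1 h2) (h : G) :
    lift (𝔾 := 𝔾) y φ h1 h2 (𝔾.of h) = φ h := by
  change RingQuot.liftAlgHom k _ (RingQuot.mkAlgHom k _ _) = _
  rw [RingQuot.liftAlgHom_mkAlgHom_apply]
  simp

theorem algHom_ext {f f' : 𝔾.A →ₐ[k] B} (hx : f 𝔾.x = f' 𝔾.x)
    (hof : ∀ h, f (𝔾.of h) = f' (𝔾.of h)) : f = f' := by
  refine RingQuot.ringQuot_ext' k f f' (FreeAlgebra.hom_ext ?_)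
  ext a
  cases a with
  | x => exact hx
  | grp h => exact hof h

theorem induction {P : 𝔾.A → Prop} (hx : P 𝔾.x) (hof : ∀ h, P (𝔾.of h))
    (hk : ∀ c : k, P (algebraMap k 𝔾.A c)) (hadd : ∀ a b, P a → P b → P (a + b))
    (hmul : ∀ a b, P a → P b → P (a * b)) (a : 𝔾.A) : P a := by
  obtain ⟨a, rfl⟩ := RingQuot.mkAlgHom_surjective k (Rel 𝔾) a
  induction a using FreeAlgebra.induction with
  | grade0 c => rw [AlgHom.commutes]; exact hk c
  | grade1 a =>
    cases a with
    | x => exact hx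
    | grp h => exact hof h
  | mul a b ha hb => rw [map_mul]; exact hmul _ _ ha hb
  | add a b ha hb => rw [map_add]; exact hadd _ _ ha hb

end Lift

section QBinomial

/-- The Gaussian binomial coefficients. -/
def gauss (q : k) : ℕ → ℕ → k
  | _, 0 => 1
  | 0, _ + 1 => 0
  | n + 1, j + 1 => gauss q n j + q ^ (j + 1) * gauss q n (j + 1)

theorem gauss_zero (q : k) (n : ℕ) : gauss q n 0 = 1 := by
  cases n <;> rfl

theorem gauss_succ (q : k) (n j : ℕ) :
    gauss q (n + 1) (j + 1) = gauss q n j + q ^ (j + 1) * gauss q n (j + 1) := rfl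

theorem gauss_of_lt (q : k) : ∀ n j : ℕ, n < j → gauss q n j = 0
  | 0, j + 1, _ => rfl
  | n + 1, j + 1, h => by
    rw [gauss_succ, gauss_of_lt q n j (by omega), gauss_of_lt q n (j + 1) (by omega)]
    ring

theorem gauss_aux (q : k) : ∀ n j m : ℕ, n = j + m →
    (1 - q ^ (j + 1)) * gauss q n (j + 1) = (1 - q ^ m) * gauss q n j
  | 0, j, m, h => by
    obtain ⟨rfl, rfl⟩ : j = 0 ∧ m = 0 := by omega
    rw [gauss_of_lt q 0 1 (by omega)]
    simp
  | n + 1, 0, m, h => by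
    obtain rfl : m = n + 1 := by omega
    have := gauss_aux q n 0 n (by omega)
    rw [gauss_zero] at this ⊢
    rw [gauss_succ, gauss_zero]
    linear_combination q * this
  | n + 1, j + 1, 0, h => by
    rw [gauss_of_lt q _ _ (by omega)]
    simp
  | n + 1, j + 1, m + 1, h => by
    have h1 := gauss_aux q n j (m + 1) (by omega)
    have h2 := gauss_aux q n (j + 1) m (by omega)
    rw [gauss_succ, gauss_succ]
    linear_combination q ^ (j + 2) * h2 + h1

theorem gauss_eq_zero {q : k} {n j : ℕ} (hq : IsPrimitiveRoot q (n + 1)) (hj : j < n) :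
    gauss q (n + 1) (j + 1) = 0 := by
  have h := gauss_aux q n j (n - j) (by omega)
  have h3 : (1 - q ^ (j + 1)) * gauss q (n + 1) (j + 1) = (1 - q ^ (n + 1)) * gauss q n j := by
    rw [gauss_succ]
    have e : q ^ (n + 1) = q ^ (j + 1) * q ^ (n - j) := by
      rw [← pow_add]
      congr 1
      omega
    rw [e]
    linear_combination q ^ (j + 1) * h
  rw [hq.pow_eq_one, sub_self, zero_mul] at h3
  refine (mul_eq_zero.1 h3).resolve_left (sub_ne_zero.2 fun h0 => ?_)
  exact hq.pow_ne_one_of_pos_of_lt (by omega) (by omega) h0.symm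

variable {B : Type*} [Ring B] [Algebra k B]

theorem mul_pow_of_qcomm {q : k} {u v : B} (h : v * u = q • (u * v)) (j : ℕ) :
    v * u ^ j = q ^ j • (u ^ j * v) := by
  induction j with
  | zero => simp
  | succ j ih =>
    rw [pow_succ, ← mul_assoc, ih, smul_mul_assoc, mul_assoc, h, mul_smul_comm, smul_smul,
      ← mul_assoc, ← pow_succ]

theorem add_pow_gauss {q : k} {u v : B} (h : v * u = q • (u * v)) (n : ℕ) :
    (u + v) ^ n = ∑ j ∈ Finset.range (n + 1), gauss q n j • (u ^ j * v ^ (n - j)) := by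
  induction n with
  | zero => simp [gauss]
  | succ n ih =>
    rw [pow_succ', ih, Finset.sum_range_succ' (n := n + 1), add_mul, Finset.mul_sum, Finset.mul_sum]
    simp only [gauss_succ, gauss_zero, add_smul, Finset.sum_add_distrib]
    have e1 : ∀ j ∈ Finset.range (n + 1), u * gauss q n j • (u ^ j * v ^ (n - j)) =
        gauss q n j • (u ^ (j + 1) * v ^ (n + 1 - (j + 1))) := fun j _ => by
      rw [mul_smul_comm, ← mul_assoc, ← pow_succ', Nat.add_sub_add_right]
    have e2 : ∀ j ∈ Finset.range (n + 1), v * gauss q n j • (u ^ j * v ^ (n - j)) =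
        (q ^ j * gauss q n j) • (u ^ j * v ^ (n + 1 - j)) := fun j hj => by
      rw [mul_smul_comm, ← mul_assoc, mul_pow_of_qcomm h, smul_mul_assoc, mul_assoc, ← pow_succ',
        smul_smul, mul_comm (gauss q n j), Nat.succ_sub (Finset.mem_range_succ_iff.1 hj)]
    rw [Finset.sum_congr rfl e1, Finset.sum_congr rfl e2, add_assoc]
    congr 1
    rw [Finset.sum_range_succ', Finset.sum_range_succ (n := n)]
    simp [gauss_zero, gauss_of_lt]

/-- If `q` is a primitive `n`-th root of unity and `vu = q uv`, then `(u + v)ⁿ = uⁿ + vⁿ`. -/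
theorem add_pow_of_primitive {q : k} {u v : B} {n : ℕ} (hn : 0 < n) (hq : IsPrimitiveRoot q n)
    (h : v * u = q • (u * v)) : (u + v) ^ n = u ^ n + v ^ n := by
  obtain ⟨n, rfl⟩ := Nat.exists_eq_add_of_lt hn
  simp only [zero_add] at *
  rw [add_pow_gauss h, Finset.sum_range_succ', Finset.sum_range_succ]
  rw [Finset.sum_eq_zero fun j hj => by rw [gauss_eq_zero hq (Finset.mem_range.1 hj), zero_smul]]
  have : gauss q (n + 1) (n + 1) = 1 := by
    clear hq hn
    induction n with
    | zero => simp [gauss]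
    | succ n ih => rw [gauss_succ, ih, gauss_of_lt q _ _ (by omega)]; simp
  simp [this, gauss_zero]

/-- If `vu = q uv`, then `(uv)ⁿ = q ^ (n (n - 1) / 2) uⁿ vⁿ`. -/
theorem mul_pow_qcomm {q : k} {u v : B} (h : v * u = q • (u * v)) (n : ℕ) :
    (u * v) ^ n = q ^ (n * (n - 1) / 2) • (u ^ n * v ^ n) := by
  induction n with
  | zero => simp
  | succ n ih =>
    rw [pow_succ', ih, mul_smul_comm, mul_assoc, ← mul_assoc v, mul_pow_of_qcomm h, smul_mul_assoc,
      mul_smul_comm, smul_smul, ← pow_add, mul_assoc (u ^ n), ← pow_succ', ← mul_assoc,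
      ← pow_succ']
    congr 2
    rw [← Finset.sum_range_id, ← Finset.sum_range_id, Finset.sum_range_succ]

theorem neg_one_pow_mul {q : k} {n : ℕ} (hn : 0 < n) (hq : IsPrimitiveRoot q n) :
    (-1) ^ n * q ^ (n * (n - 1) / 2) = -1 := by
  obtain ⟨m, rfl | rfl⟩ := n.even_or_odd'
  · have e : 2 * m * (2 * m - 1) / 2 = m * (2 * m - 1) := by
      rw [mul_assoc, Nat.mul_div_cancel_left _ (by norm_num)]
    have hm : q ^ m = -1 := by
      have h1 : q ^ m * q ^ m = 1 := by
        rw [← pow_add, ← two_mul, hq.pow_eq_one]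
      refine (mul_self_eq_one_iff.1 h1).resolve_left fun h => ?_
      exact hq.pow_ne_one_of_pos_of_lt (by omega) (by omega) h
    rw [e, pow_mul q, hm, pow_mul, neg_one_sq, one_pow, one_mul]
    exact Odd.neg_one_pow ⟨m - 1, by omega⟩
  · have e : (2 * m + 1) * (2 * m + 1 - 1) / 2 = (2 * m + 1) * m := by
      rw [Nat.add_sub_cancel, mul_left_comm, Nat.mul_div_cancel_left _ (by norm_num)]
    rw [e, pow_mul, hq.pow_eq_one, one_pow, mul_one]
    exact Odd.neg_one_pow ⟨m, rfl⟩

end QBinomial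

theorem d_pos : 0 < 𝔾.d := by
  have : IsOfFinOrder (𝔾.χ 𝔾.g) := MonoidHom.isOfFinOrder 𝔾.χ (isOfFinOrder_of_finite 𝔾.g)
  exact this.orderOf_pos

theorem isPrimitiveRoot : IsPrimitiveRoot ((𝔾.χ 𝔾.g : kˣ) : k) 𝔾.d :=
  IsPrimitiveRoot.coe_units_iff.2 (IsPrimitiveRoot.orderOf _)

theorem comm_g (h : G) : h * 𝔾.g = 𝔾.g * h := Subgroup.mem_center_iff.1 𝔾.g_mem_center h

instance : (Subgroup.zpowers 𝔾.g).Normal :=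
⟨fun n hn h => by
  obtain ⟨i, rfl⟩ := Subgroup.mem_zpowers_iff.1 hn
  have : Commute h (𝔾.g ^ i) := Commute.zpow_right (𝔾.comm_g h) i
  rw [this.eq, mul_inv_cancel_right]
  exact hn⟩

/-! ### The Hopf algebra structure -/

/-- The map `h ↦ h ⊗ h`. -/
def ofTensor : G →* 𝔾.A ⊗[k] 𝔾.A where
  toFun h := 𝔾.of h ⊗ₜ 𝔾.of h
  map_one' := by rw [map_one, Algebra.TensorProduct.one_def]
  map_mul' h l := by rw [map_mul, Algebra.TensorProduct.tmul_mul_tmul]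

/-- The comultiplication: `Δ(x) = 1 ⊗ x + x ⊗ g` and `Δ(h) = h ⊗ h`. -/
def comulHom : 𝔾.A →ₐ[k] 𝔾.A ⊗[k] 𝔾.A :=
  lift (1 ⊗ₜ 𝔾.x + 𝔾.x ⊗ₜ 𝔾.of 𝔾.g) 𝔾.ofTensor
    (fun h => by
      simp only [ofTensor, MonoidHom.coe_mk, OneHom.coe_mk, add_mul, mul_add,
        Algebra.TensorProduct.tmul_mul_tmul, one_mul, mul_one, x_mul_of, ← map_mul, comm_g,
        smul_add, TensorProduct.tmul_smul, TensorProduct.smul_tmul'])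
    (by
      have hq : (1 ⊗ₜ 𝔾.x) * (𝔾.x ⊗ₜ 𝔾.of 𝔾.g) =
          (𝔾.χ 𝔾.g : k) • ((𝔾.x ⊗ₜ 𝔾.of 𝔾.g) * ((1 : 𝔾.A) ⊗ₜ[k] 𝔾.x)) := by
        simp only [Algebra.TensorProduct.tmul_mul_tmul, one_mul, mul_one, x_mul_of,
          TensorProduct.tmul_smul]
      rw [add_comm, add_pow_of_primitive 𝔾.d_pos 𝔾.isPrimitiveRoot hq]
      simp only [Algebra.TensorProduct.tmul_pow, one_pow, x_pow, ofTensor, MonoidHom.coe_mk,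
        OneHom.coe_mk, ← map_pow, TensorProduct.tmul_smul, ← TensorProduct.smul_tmul', ← smul_add,
        TensorProduct.tmul_sub, TensorProduct.sub_tmul, Algebra.TensorProduct.one_def]
      congr 1
      abel)

/-- The counit: `ε(x) = 0` and `ε(h) = 1`. -/
def counitHom : 𝔾.A →ₐ[k] k :=
  lift 0 1 (fun h => by simp) (by simp [𝔾.d_pos.ne'])

@[simp] theorem comulHom_x : 𝔾.comulHom 𝔾.x = 1 ⊗ₜ 𝔾.x + 𝔾.x ⊗ₜ 𝔾.of 𝔾.g := lift_x _ _ _ _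

@[simp] theorem comulHom_of (h : G) : 𝔾.comulHom (𝔾.of h) = 𝔾.of h ⊗ₜ 𝔾.of h :=
  lift_of _ _ _ _ h

@[simp] theorem counitHom_x : 𝔾.counitHom 𝔾.x = 0 := lift_x _ _ _ _

@[simp] theorem counitHom_of (h : G) : 𝔾.counitHom (𝔾.of h) = 1 := lift_of _ _ _ _ h

instance : Bialgebra k 𝔾.A :=
  Bialgebra.ofAlgHom 𝔾.comulHom 𝔾.counitHom
    (algHom_ext (by simp [TensorProduct.add_tmul, TensorProduct.tmul_add,
        Algebra.TensorProduct.one_def, add_assoc]) (fun h => by simp))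
    (algHom_ext (by simp) (fun h => by simp))
    (algHom_ext (by simp) (fun h => by simp))

@[simp] theorem comul_x : Coalgebra.comul (R := k) 𝔾.x = 1 ⊗ₜ 𝔾.x + 𝔾.x ⊗ₜ 𝔾.of 𝔾.g :=
  𝔾.comulHom_x

@[simp] theorem comul_of (h : G) : Coalgebra.comul (R := k) (𝔾.of h) = 𝔾.of h ⊗ₜ 𝔾.of h :=
  𝔾.comulHom_of h

@[simp] theorem counit_x : Coalgebra.counit (R := k) 𝔾.x = 0 := 𝔾.counitHom_x

@[simp] theorem counit_of (h : G) : Coalgebra.counit (R := k) (𝔾.of h) = 1 := 𝔾.counitHom_of h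

open MulOpposite in
/-- The antipode `S(x) = -x g⁻¹`, `S(h) = h⁻¹`, as an algebra map to the opposite algebra. -/
def antipodeHom : 𝔾.A →ₐ[k] 𝔾.Aᵐᵒᵖ :=
  lift (op (-(𝔾.x * 𝔾.of 𝔾.g⁻¹)))
    { toFun := fun h => op (𝔾.of h⁻¹)
      map_one' := by simp
      map_mul' := fun h l => by rw [mul_inv_rev, map_mul, op_mul] }
    (fun h => by
      simp only [MonoidHom.coe_mk, OneHom.coe_mk, ← op_mul, ← op_smul]
      congr 1
      have hc : 𝔾.g⁻¹ * h⁻¹ = h⁻¹ * 𝔾.g⁻¹ := by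
        rw [← mul_inv_rev, ← mul_inv_rev, comm_g]
      rw [neg_mul, mul_neg, smul_neg, mul_assoc, ← map_mul, hc, map_mul, ← mul_assoc (𝔾.x) (𝔾.of h⁻¹),
        x_mul_of _ h⁻¹, smul_mul_assoc, smul_smul, mul_assoc]
      simp)
    (by
      have hq : 𝔾.of 𝔾.g⁻¹ * 𝔾.x = (𝔾.χ 𝔾.g : k) • (𝔾.x * 𝔾.of 𝔾.g⁻¹) := by
        rw [x_mul_of, smul_smul]
        simp
      simp only [MonoidHom.coe_mk, OneHom.coe_mk, ← op_pow, ← op_smul, ← op_one, ← op_sub]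
      congr 1
      rw [neg_pow, mul_pow_qcomm hq, mul_smul_comm, ← map_pow, x_pow]
      have e : ((-1 : 𝔾.A) ^ 𝔾.d) = ((-1 : k) ^ 𝔾.d) • (1 : 𝔾.A) := by
        rw [← Algebra.algebraMap_eq_smul_one, map_pow, map_neg, map_one]
      rw [e, smul_mul_assoc, one_mul, smul_smul, mul_comm,
        neg_one_pow_mul 𝔾.d_pos 𝔾.isPrimitiveRoot, smul_mul_assoc, sub_mul, one_mul, ← map_mul,
        inv_pow, mul_inv_cancel, map_one, neg_one_smul, ← smul_neg, neg_sub])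

/-- The antipode as a linear map. -/
def antipodeLin : 𝔾.A →ₗ[k] 𝔾.A :=
  (MulOpposite.opLinearEquiv k).symm.toLinearMap ∘ₗ 𝔾.antipodeHom.toLinearMap

@[simp] theorem antipodeLin_x : 𝔾.antipodeLin 𝔾.x = -(𝔾.x * 𝔾.of 𝔾.g⁻¹) := by
  simp [antipodeLin, antipodeHom]

@[simp] theorem antipodeLin_of (h : G) : 𝔾.antipodeLin (𝔾.of h) = 𝔾.of h⁻¹ := by
  simp [antipodeLin, antipodeHom]

@[simp] theorem antipodeLin_one : 𝔾.antipodeLin 1 = 1 := by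
  simp [antipodeLin]

theorem antipodeLin_mul (a b : 𝔾.A) :
    𝔾.antipodeLin (a * b) = 𝔾.antipodeLin b * 𝔾.antipodeLin a := by
  simp [antipodeLin]

open Coalgebra WithConv in
instance : HopfAlgebra k 𝔾.A :=
  HopfAlgebra.ofConvInverse 𝔾.antipodeLin
    (by
      ext a
      induction a using induction with
      | hx => simp [mul_assoc, ← map_mul]
      | hof h => simp [← map_mul]
      | hk c => simp [Algebra.algebraMap_eq_smul_one, Algebra.TensorProduct.one_def]
      | hadd a b ha hb => simpa using congr($ha + $hb)
      | hmul a b ha hb =>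
        rw [((ℛ k a).mul (ℛ k b)).convMul_apply]
        rw [(ℛ k a).convMul_apply] at ha
        rw [(ℛ k b).convMul_apply] at hb
        simp only [LinearMap.convOne_apply, LinearMap.id_coe, id_eq] at ha hb
        simp only [Coalgebra.Repr.mul_index, Coalgebra.Repr.mul_left, Coalgebra.Repr.mul_right,
          Finset.sum_product_right, antipodeLin_mul, mul_assoc, LinearMap.convOne_apply, Bialgebra.counit_mul,
          map_mul, ← hb, Finset.mul_sum, LinearMap.id_coe, id_eq]
        refine Finset.sum_congr rfl fun j _ => ?_
        rw [← Finset.mul_sum]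
        simp only [← mul_assoc, ← Finset.sum_mul]
        rw [ha, Algebra.commutes])
    (by
      ext a
      induction a using induction with
      | hx => simp
      | hof h => simp [← map_mul]
      | hk c => simp [Algebra.algebraMap_eq_smul_one, Algebra.TensorProduct.one_def]
      | hadd a b ha hb => simpa using congr($ha + $hb)
      | hmul a b ha hb =>
        rw [((ℛ k a).mul (ℛ k b)).convMul_apply]
        rw [(ℛ k a).convMul_apply] at ha
        rw [(ℛ k b).convMul_apply] at hb
        simp only [LinearMap.convOne_apply, LinearMap.id_coe, id_eq] at ha hb
        simp only [Coalgebra.Repr.mul_index, Coalgebra.Repr.mul_left, Coalgebra.Repr.mul_right,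
          Finset.sum_product, antipodeLin_mul, mul_assoc, LinearMap.convOne_apply, Bialgebra.counit_mul,
          map_mul, ← ha, Finset.sum_mul, LinearMap.id_coe, id_eq]
        refine Finset.sum_congr rfl fun i _ => ?_
        have e : ∀ j, (ℛ k a).left i * ((ℛ k b).left j *
            (𝔾.antipodeLin ((ℛ k b).right j) * 𝔾.antipodeLin ((ℛ k a).right i))) =
            (ℛ k a).left i * ((ℛ k b).left j * 𝔾.antipodeLin ((ℛ k b).right j)) *
              𝔾.antipodeLin ((ℛ k a).right i) := fun j => by simp only [mul_assoc]
        simp only [e]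
        rw [← Finset.sum_mul, ← Finset.mul_sum, hb, mul_assoc, Algebra.commutes])

end GroupDatum

end GroupDatum

end

/-!
A lazy cocycle `σ` on `A = A(𝔾)` twists the product to `a · b = σ(a₁, b₁) a₂ b₂`; laziness says
that `σ(a₂, b₂) a₁ b₁` is the same element, and the cocycle condition reads
`σ(a · b, c) = σ(a, b · c)` (`LazyCohomology.isLeftCocycle_iff`).

The monomials `l xⁿ` with `l ∈ G` and `n < d` form a basis of `A`. Through the coalgebra
projection onto the span of `G` that kills the `l xⁿ` with `n > 0`, the coalgebra `k[G]` coacts on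
both sides, and `l xⁿ` has left degree `l` and right degree `l gⁿ`. Laziness compares the two
degrees: it forces `σ(h, l xⁿ) = σ(l xⁿ, h) = 0` for `0 < n < d`, `σ(g, ·) = σ(·, g) = ε`, and
`σ(x, l xⁿ) = 0` unless `n = d - 1`. By associativity of the twisted product, `σ` is then
determined by its restriction to `G`, which factors through `G / ⟨g⟩`, and by the scalar
`s = σ(x, x ^ (d - 1))`, the parameter (`GroupDatum.eq_of_apply_of`). The parameter is additive
(`GroupDatum.param_mul`), and associativity of the triple `x`, `x ^ (d - 1)`, `l` shows that it
vanishes outside type I (`GroupDatum.isTypeI_of_param_ne_zero`).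

Conversely, the bialgebra map from `A` to the group algebra of `G / ⟨g⟩` with `x ↦ 0` is cocentral,
so that normalized group cocycles pull back to lazy cocycles with parameter zero
(`GroupDatum.infl₂_mem`). In type I, each scalar `s` is the parameter of a lazy cocycle that is
trivial on `G`: the one that twists the product of `A` into that of the algebra in which `x ^ d = s`
(`GroupDatum.Deformed.isLazyCocycle_cocycle`). It is invertible because the product of the cocycles
for `s` and `-s` has trivial restriction and trivial parameter.

Finally, a lazy cocycle is a lazy coboundary if and only if its restriction to `G / ⟨g⟩` is a
coboundary and its parameter is zero (`GroupDatum.mem_B₂L_iff`). Hence restriction and parameter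
induce the isomorphisms.
-/

noncomputable section

open scoped TensorProduct
open WithConv LinearMap Coalgebra

namespace GroupDatum

variable {k : Type*} [Field k] {G : Type*} [Group G] [Finite G] (𝔾 : GroupDatum k G)

/-! ### The algebras with `x ^ d = μ (1 - g ^ d) + s` -/

open FreeAlgebra in
/-- The defining relations of the algebra `𝔾.Deformed s`: those of `A(𝔾)`, with `x ^ d` shifted by
the scalar `s`. -/
inductive DeformedRel (s : k) : FreeAlgebra k (Gen G) → FreeAlgebra k (Gen G) → Prop
  | one : DeformedRel s (ι k (.grp 1)) 1
  | mul (h l : G) : DeformedRel s (ι k (.grp h) * ι k (.grp l)) (ι k (.grp (h * l)))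
  | comm (h : G) :
      DeformedRel s (ι k .x * ι k (.grp h)) ((𝔾.χ h : k) • (ι k (.grp h) * ι k .x))
  | pow : DeformedRel s (ι k .x ^ 𝔾.d) (𝔾.μ • (1 - ι k (.grp (𝔾.g ^ 𝔾.d))) + algebraMap k _ s)

/-- The algebra generated by `x` and `G` with the relations of `A(𝔾)`, except that
`x ^ d = μ (1 - g ^ d) + s`. For `s = 0` it is `A(𝔾)`; in type I it is the Galois object
of `A(𝔾)` attached to `s`. -/
def Deformed (s : k) : Type _ := RingQuot (DeformedRel 𝔾 s)

namespace Deformed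

variable {𝔾} {s : k}

instance : Ring (𝔾.Deformed s) := inferInstanceAs (Ring (RingQuot (DeformedRel 𝔾 s)))

instance : Algebra k (𝔾.Deformed s) := inferInstanceAs (Algebra k (RingQuot (DeformedRel 𝔾 s)))

variable (𝔾 s) in
/-- The generator `x`. -/
def x : 𝔾.Deformed s := RingQuot.mkAlgHom k (DeformedRel 𝔾 s) (FreeAlgebra.ι k .x)

variable (𝔾 s) in
/-- The image of `h ∈ G`. -/
def of : G →* 𝔾.Deformed s where
  toFun h := RingQuot.mkAlgHom k (DeformedRel 𝔾 s) (FreeAlgebra.ι k (.grp h))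
  map_one' := (RingQuot.mkAlgHom_rel k DeformedRel.one).trans (map_one _)
  map_mul' h l := (RingQuot.mkAlgHom_rel k (DeformedRel.mul h l)).symm.trans (map_mul _ _ _)

theorem x_mul_of (h : G) : x 𝔾 s * of 𝔾 s h = (𝔾.χ h : k) • (of 𝔾 s h * x 𝔾 s) := by
  have := RingQuot.mkAlgHom_rel k (DeformedRel.comm (𝔾 := 𝔾) (s := s) h)
  rwa [map_mul, map_smul, map_mul] at this

theorem x_pow : x 𝔾 s ^ 𝔾.d = 𝔾.μ • (1 - of 𝔾 s (𝔾.g ^ 𝔾.d)) + algebraMap k _ s := by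
  have := RingQuot.mkAlgHom_rel k (DeformedRel.pow (𝔾 := 𝔾) (s := s))
  rwa [map_pow, map_add, map_smul, map_sub, map_one, AlgHom.commutes] at this

variable {B : Type*} [Ring B] [Algebra k B]

/-- The universal property of `𝔾.Deformed s`. -/
def lift (y : B) (φ : G →* B) (h1 : ∀ h, y * φ h = (𝔾.χ h : k) • (φ h * y))
    (h2 : y ^ 𝔾.d = 𝔾.μ • (1 - φ (𝔾.g ^ 𝔾.d)) + algebraMap k B s) : 𝔾.Deformed s →ₐ[k] B :=
  RingQuot.liftAlgHom k ⟨FreeAlgebra.lift k (fun | .x => y | .grp h => φ h), by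
    intro a b hab
    cases hab with
    | one => simp
    | mul h l => simp
    | comm h => simpa using h1 h
    | pow => simpa using h2⟩

@[simp] theorem lift_x (y : B) (φ : G →* B) (h1 h2) :
    lift (𝔾 := 𝔾) (s := s) y φ h1 h2 (x 𝔾 s) = y := by
  change RingQuot.liftAlgHom k _ (RingQuot.mkAlgHom k _ _) = _
  rw [RingQuot.liftAlgHom_mkAlgHom_apply]
  simp

@[simp] theorem lift_of (y : B) (φ : G →* B) (h1 h2) (h : G) :
    lift (𝔾 := 𝔾) (s := s) y φ h1 h2 (of 𝔾 s h) = φ h := by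
  change RingQuot.liftAlgHom k _ (RingQuot.mkAlgHom k _ _) = _
  rw [RingQuot.liftAlgHom_mkAlgHom_apply]
  simp

theorem induction {P : 𝔾.Deformed s → Prop} (hx : P (x 𝔾 s)) (hof : ∀ h, P (of 𝔾 s h))
    (hk : ∀ c : k, P (algebraMap k _ c)) (hadd : ∀ a b, P a → P b → P (a + b))
    (hmul : ∀ a b, P a → P b → P (a * b)) (a : 𝔾.Deformed s) : P a := by
  obtain ⟨a, rfl⟩ := RingQuot.mkAlgHom_surjective k (DeformedRel 𝔾 s) a
  induction a using FreeAlgebra.induction with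
  | grade0 c => rw [AlgHom.commutes]; exact hk c
  | grade1 a =>
    cases a with
    | x => exact hx
    | grp h => exact hof h
  | mul a b ha hb => rw [map_mul]; exact hmul _ _ ha hb
  | add a b ha hb => rw [map_add]; exact hadd _ _ ha hb

end Deformed

/-! ### Bases of monomials -/

section Spanning

variable {𝔾} {B : Type*} [Ring B] [Algebra k B] {y : B} {φ : G →* B}

theorem pow_mul_of (h1 : ∀ h, y * φ h = (𝔾.χ h : k) • (φ h * y)) (n : ℕ) (h : G) :
    y ^ n * φ h = ((𝔾.χ h : k) ^ n) • (φ h * y ^ n) := by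
  induction n with
  | zero => simp
  | succ n ih =>
    rw [pow_succ, mul_assoc, h1, mul_smul_comm, ← mul_assoc, ih, smul_mul_assoc, smul_smul,
      mul_assoc, ← pow_succ']

/-- A linear condition that holds for the monomials `h yⁿ`, `n < d`, holds for all elements of an
algebra generated by `G` and `y`, if `y` and `G` satisfy the relations of `𝔾.Deformed s`. -/
theorem span_monomials {s : k} (h1 : ∀ h, y * φ h = (𝔾.χ h : k) • (φ h * y))
    (h2 : y ^ 𝔾.d = 𝔾.μ • (1 - φ (𝔾.g ^ 𝔾.d)) + algebraMap k B s)
    (hgen : ∀ S : Subalgebra k B, y ∈ S → (∀ h, φ h ∈ S) → ∀ b, b ∈ S)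
    (N : Submodule k B) (hN : ∀ h n, n < 𝔾.d → φ h * y ^ n ∈ N) (b : B) : b ∈ N := by
  have hN' : ∀ n h, φ h * y ^ n ∈ N := by
    intro n
    induction n using Nat.strong_induction_on with
    | _ n ih =>
      intro h
      by_cases hn : n < 𝔾.d
      · exact hN h n hn
      · obtain ⟨m, rfl⟩ := Nat.exists_eq_add_of_le (not_lt.1 hn)
        have hm : m < 𝔾.d + m := by have := 𝔾.d_pos; omega
        rw [pow_add, h2, add_mul, mul_add, smul_mul_assoc, mul_smul_comm, sub_mul, mul_sub, one_mul,
          ← mul_assoc (φ h) (φ _), ← map_mul, Algebra.algebraMap_eq_smul_one, smul_mul_assoc,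
          one_mul, mul_smul_comm]
        exact N.add_mem (N.smul_mem _ (N.sub_mem (ih m hm _) (ih m hm _)))
          (N.smul_mem _ (ih m hm _))
  let M : Submodule k B := Submodule.span k (Set.range fun p : G × ℕ => φ p.1 * y ^ p.2)
  have hMN : M ≤ N := Submodule.span_le.2 (by rintro _ ⟨p, rfl⟩; exact hN' _ _)
  have hM1 : (1 : B) ∈ M := Submodule.subset_span ⟨(1, 0), by simp⟩
  have hMM : ∀ a b, a ∈ M → b ∈ M → a * b ∈ M := by
    intro a b ha hb
    have := Submodule.mul_mem_mul ha hb
    rw [Submodule.span_mul_span] at this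
    refine Submodule.span_le.2 ?_ this
    rintro _ ⟨_, ⟨⟨l, n⟩, rfl⟩, _, ⟨⟨h, m⟩, rfl⟩, rfl⟩
    simp only [SetLike.mem_coe]
    rw [mul_assoc (φ l), ← mul_assoc (y ^ n), pow_mul_of h1, smul_mul_assoc, mul_smul_comm,
      mul_assoc (φ h), ← mul_assoc, ← map_mul, ← pow_add]
    exact M.smul_mem _ (Submodule.subset_span ⟨(l * h, n + m), rfl⟩)
  exact hMN (hgen (M.toSubalgebra hM1 hMM) (Submodule.subset_span ⟨(1, 1), by simp⟩)
    (fun h => Submodule.subset_span ⟨(h, 0), by simp⟩) b)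

end Spanning

/-- Linear maps on `A(𝔾)` agree if they agree on the monomials `h xⁿ`, `n < d`. -/
theorem linearMap_ext {M : Type*} [AddCommGroup M] [Module k M] {f f' : 𝔾.A →ₗ[k] M}
    (h : ∀ l n, n < 𝔾.d → f (𝔾.of l * 𝔾.x ^ n) = f' (𝔾.of l * 𝔾.x ^ n)) : f = f' := by
  ext b
  refine span_monomials (s := 0) 𝔾.x_mul_of (by simpa using 𝔾.x_pow) (fun S hx hG b => ?_)
    (LinearMap.eqLocus f f') h b
  exact induction hx hG S.algebraMap_mem (fun _ _ => S.add_mem) (fun _ _ => S.mul_mem) b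

/-- Linear maps on `𝔾.Deformed s` agree if they agree on the monomials `h xⁿ`, `n < d`. -/
theorem Deformed.linearMap_ext {s : k} {M : Type*} [AddCommGroup M] [Module k M]
    {f f' : 𝔾.Deformed s →ₗ[k] M}
    (h : ∀ l n, n < 𝔾.d → f (of 𝔾 s l * x 𝔾 s ^ n) = f' (of 𝔾 s l * x 𝔾 s ^ n)) : f = f' := by
  ext b
  refine span_monomials (s := s) x_mul_of x_pow (fun S hx hG b => ?_)
    (LinearMap.eqLocus f f') h b
  exact Deformed.induction hx hG S.algebraMap_mem (fun _ _ => S.add_mem) (fun _ _ => S.mul_mem) b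

section Coordinates

/-- The functions `F : G → ℕ → k` that extend to linear forms `l xⁿ ↦ F l n` on
`𝔾.Deformed s`. -/
def recurrent (s : k) : Submodule k (G → ℕ → k) where
  carrier := {F | ∀ l n, F l (n + 𝔾.d) = 𝔾.μ * (F l n - F (l * 𝔾.g ^ 𝔾.d) n) + s * F l n}
  zero_mem' := fun l n => by simp
  add_mem' := fun {F F'} h h' l n => by
    simp only [Pi.add_apply, h l n, h' l n]
    ring
  smul_mem' := fun c F h l n => by
    simp only [Pi.smul_apply, smul_eq_mul, h l n]
    ring

variable {s : k}

/-- The action of `x` on linear forms `F`, by translation: `(x F)(b) = F(b x)`. -/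
def shiftX : Module.End k (𝔾.recurrent s) where
  toFun F := ⟨fun l n => F.1 l (n + 1), fun l n => by
    simpa only [add_right_comm] using F.2 l (n + 1)⟩
  map_add' _ _ := rfl
  map_smul' _ _ := rfl

/-- The action of `h ∈ G` on linear forms `F`, by translation: `(h F)(b) = F(b h)`. -/
def shiftOf (hχ : 𝔾.μ ≠ 0 ∨ s ≠ 0 → 𝔾.χ ^ 𝔾.d = 1) : G →* Module.End k (𝔾.recurrent s) where
  toFun h :=
    { toFun := fun F => ⟨fun l n => (𝔾.χ h : k) ^ n * F.1 (l * h) n, fun l n => by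
        beta_reduce
        rw [F.2 (l * h) n, mul_assoc l h, (Commute.pow_right (𝔾.comm_g h) 𝔾.d : Commute h _).eq,
          ← mul_assoc]
        by_cases hc : 𝔾.μ ≠ 0 ∨ s ≠ 0
        · have : (𝔾.χ h : k) ^ 𝔾.d = 1 := by
            simpa using congr((($(hχ hc) h : kˣ) : k))
          rw [pow_add, this]
          ring
        · push Not at hc
          simp only [hc.1, hc.2, zero_mul, add_zero, mul_zero]⟩
      map_add' := fun F F' => by
        ext l n
        simp [mul_add]
      map_smul' := fun c F => by
        ext l n
        simp [mul_left_comm] }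
  map_one' := by
    ext F l n
    simp
  map_mul' h h' := by
    ext F l n
    simp [mul_pow, mul_assoc]

theorem shiftX_apply (F : 𝔾.recurrent s) (l : G) (n : ℕ) :
    (𝔾.shiftX F).1 l n = F.1 l (n + 1) := rfl

theorem shiftOf_apply (hχ : 𝔾.μ ≠ 0 ∨ s ≠ 0 → 𝔾.χ ^ 𝔾.d = 1) (h : G) (F : 𝔾.recurrent s) (l : G)
    (n : ℕ) : (𝔾.shiftOf hχ h F).1 l n = (𝔾.χ h : k) ^ n * F.1 (l * h) n := rfl

theorem shiftX_pow_apply (m : ℕ) (F : 𝔾.recurrent s) (l : G) (n : ℕ) :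
    ((𝔾.shiftX ^ m) F).1 l n = F.1 l (n + m) := by
  induction m generalizing n with
  | zero => rfl
  | succ m ih => rw [pow_succ', Module.End.mul_apply, shiftX_apply, ih, add_right_comm, add_assoc]

/-- The representation of `𝔾.Deformed s` by translations. -/
def translation (hχ : 𝔾.μ ≠ 0 ∨ s ≠ 0 → 𝔾.χ ^ 𝔾.d = 1) :
    𝔾.Deformed s →ₐ[k] Module.End k (𝔾.recurrent s) :=
  Deformed.lift 𝔾.shiftX (𝔾.shiftOf hχ)
    (fun h => by
      ext F l n
      simp [shiftX_apply, shiftOf_apply, pow_succ, mul_left_comm, mul_assoc])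
    (by
      have hg : (𝔾.χ 𝔾.g : k) ^ 𝔾.d = 1 := 𝔾.isPrimitiveRoot.pow_eq_one
      ext F l n
      rw [shiftX_pow_apply, F.2]
      have e := 𝔾.shiftOf_apply hχ (𝔾.g ^ 𝔾.d) F l n
      rw [𝔾.χ.map_pow, Units.val_pow_eq_pow_val, hg, one_pow, one_mul] at e
      simp [-map_pow, e, Module.algebraMap_end_apply])

/-- The monomials `l xⁿ`, `n < d`, are linearly independent in `𝔾.Deformed s`: linear forms with
arbitrary values on them exist. -/
theorem Deformed.exists_form (hχ : 𝔾.μ ≠ 0 ∨ s ≠ 0 → 𝔾.χ ^ 𝔾.d = 1) (f : G → ℕ → k) :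
    ∃ φ : 𝔾.Deformed s →ₗ[k] k, ∀ l n, n < 𝔾.d → φ (of 𝔾 s l * x 𝔾 s ^ n) = f l n := by
  let T : (G → k) → (G → k) := fun φ l => 𝔾.μ * (φ l - φ (l * 𝔾.g ^ 𝔾.d)) + s * φ l
  let F : 𝔾.recurrent s := ⟨fun l n => T^[n / 𝔾.d] (fun l => f l (n % 𝔾.d)) l, fun l n => by
    beta_reduce
    rw [Nat.add_div_right _ 𝔾.d_pos, Nat.add_mod_right, Function.iterate_succ_apply']⟩
  refine ⟨{ toFun := fun b => (𝔾.translation hχ b F).1 1 0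
            map_add' := fun a b => by simp
            map_smul' := fun c b => by simp }, fun l n hn => ?_⟩
  simp only [LinearMap.coe_mk, AddHom.coe_mk, translation, map_mul, map_pow, lift_x, lift_of,
    Module.End.mul_apply, shiftOf_apply, shiftX_pow_apply]
  simp [F, Nat.div_eq_of_lt hn, Nat.mod_eq_of_lt hn]

/-- The monomials `l xⁿ`, `n < d`, are linearly independent in `A(𝔾)`: this is
`Deformed.exists_form` for `s = 0`. -/
theorem exists_form (f : G → ℕ → k) :
    ∃ φ : 𝔾.A →ₗ[k] k, ∀ l n, n < 𝔾.d → φ (𝔾.of l * 𝔾.x ^ n) = f l n := by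
  obtain ⟨φ, hφ⟩ := Deformed.exists_form 𝔾 (s := 0) (fun h => 𝔾.χ_pow (by simpa using h)) f
  refine ⟨φ ∘ₗ (lift (Deformed.x 𝔾 0) (Deformed.of 𝔾 0) Deformed.x_mul_of
    (by simpa using Deformed.x_pow (𝔾 := 𝔾) (s := 0)) : 𝔾.A →ₐ[k] 𝔾.Deformed 0).toLinearMap,
    fun l n hn => ?_⟩
  simpa using hφ l n hn

end Coordinates
end GroupDatum

namespace LazyCohomology

/-! ### The product twisted by a lazy cocycle -/

section Twist

variable {k : Type*} [CommRing k] {A : Type*} [Ring A] [HopfAlgebra k A]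

/-- The lazy normalized left two-cocycles, not necessarily convolution invertible. -/
structure IsLazyCocycle (σ : WithConv (A ⊗[k] A →ₗ[k] k)) : Prop where
  normalized : IsNormalized σ
  lazy : IsLazy₂ σ
  cocycle : IsLeftCocycle σ

variable {σ τ : WithConv (A ⊗[k] A →ₗ[k] k)}

theorem IsLazyCocycle.one : IsLazyCocycle (1 : WithConv (A ⊗[k] A →ₗ[k] k)) :=
  have h := (Z₂L k A).one_mem
  ⟨h.1, h.2.1, h.2.2⟩

theorem IsLazyCocycle.mul (hσ : IsLazyCocycle σ) (hτ : IsLazyCocycle τ) :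
    IsLazyCocycle (σ * τ) := by
  refine ⟨?_, ?_, ?_⟩
  · have h1 := (isNormalized_iff _).1 hσ.1
    have h2 := (isNormalized_iff _).1 hτ.1
    rw [isNormalized_iff]
    simp [h1, h2]
  · have := (Commute.mul_left (show Commute _ _ from hσ.2) (show Commute _ _ from hτ.2)).eq
    rwa [← map_mul] at this
  · unfold IsLeftCocycle
    rw [map_mul, map_mul, map_mul, map_mul,
      (hτ.2.commute_mul₁₂ _).mul_mul_mul_comm, hσ.3, hτ.3,
      (hτ.2.commute_mul₂₃ _).symm.mul_mul_mul_comm]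

/-- The product `a · b = σ(a₁, b₁) a₂ b₂` twisted by `σ`. -/
def twist (σ : WithConv (A ⊗[k] A →ₗ[k] k)) (a b : A) : A :=
  (scalar A σ * toConv (LinearMap.mul' k A)) (a ⊗ₜ b)

/-- For lazy `σ`, the twisted product is also `a₁ b₁ σ(a₂, b₂)`. -/
theorem IsLazyCocycle.twist_eq (hσ : IsLazyCocycle σ) (a b : A) :
    twist σ a b = (toConv (LinearMap.mul' k A) * scalar A σ) (a ⊗ₜ b) :=
  congr($(hσ.lazy) (a ⊗ₜ b))

/-- The linear form `b ↦ σ(a, b)`. -/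
def evalLeft (σ : WithConv (A ⊗[k] A →ₗ[k] k)) (a : A) : WithConv (A →ₗ[k] k) :=
  toConv (σ.ofConv ∘ₗ TensorProduct.mk k A A a)

/-- The linear form `a ↦ σ(a, b)`. -/
def evalRight (σ : WithConv (A ⊗[k] A →ₗ[k] k)) (b : A) : WithConv (A →ₗ[k] k) :=
  toConv (σ.ofConv ∘ₗ (TensorProduct.mk k A A).flip b)

@[simp] theorem evalLeft_apply (a b : A) : evalLeft σ a b = σ (a ⊗ₜ b) := rfl

@[simp] theorem evalRight_apply (a b : A) : evalRight σ b a = σ (a ⊗ₜ b) := rfl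

variable {ι κ : Type*}

theorem twist_apply {a b : A} (ra : Coalgebra.Repr k a ι) (rb : Coalgebra.Repr k b κ) :
    twist σ a b = ∑ i ∈ ra.index, ∑ j ∈ rb.index,
      σ (ra.left i ⊗ₜ rb.left j) • (ra.right i * rb.right j) := by
  rw [twist, (ra.tmul rb).convMul_apply]
  simp [Coalgebra.Repr.tmul, scalar_apply, Finset.sum_product, Algebra.smul_def]

theorem IsLazyCocycle.twist_apply' (hσ : IsLazyCocycle σ) {a b : A} (ra : Coalgebra.Repr k a ι)
    (rb : Coalgebra.Repr k b κ) :
    twist σ a b = ∑ i ∈ ra.index, ∑ j ∈ rb.index,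
      σ (ra.right i ⊗ₜ rb.right j) • (ra.left i * rb.left j) := by
  rw [hσ.twist_eq, (ra.tmul rb).convMul_apply]
  simp [Coalgebra.Repr.tmul, scalar_apply, Finset.sum_product, Algebra.smul_def,
    Algebra.commutes]

variable (σ) in
/-- The left side `σ(a₁, b₁) σ(a₂ b₂, c)` of the cocycle condition is `σ(a · b, c)`. -/
theorem pr₁₂_mul_mul₁₂_apply (a b c : A) :
    (pullback (pr₁₂ k A) σ * pullback (mul₁₂ k A) σ) ((a ⊗ₜ b) ⊗ₜ c) =
      σ (twist σ a b ⊗ₜ c) := by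
  have hc (u : A) : σ (u ⊗ₜ c) = ∑ i ∈ (ℛ k c).index,
      counit (R := k) ((ℛ k c).left i) * σ (u ⊗ₜ (ℛ k c).right i) := by
    conv_lhs => rw [← sum_counit_smul (ℛ k c)]
    simp [TensorProduct.tmul_sum]
  have l : σ (twist σ a b ⊗ₜ c) = ∑ i ∈ (ℛ k a).index, ∑ j ∈ (ℛ k b).index,
      σ ((ℛ k a).left i ⊗ₜ (ℛ k b).left j) *
        σ (((ℛ k a).right i * (ℛ k b).right j) ⊗ₜ c) := by
    rw [twist_apply (ℛ k a) (ℛ k b)]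
    simp [TensorProduct.sum_tmul, ← TensorProduct.smul_tmul']
  rw [(((ℛ k a).tmul (ℛ k b)).tmul (ℛ k c)).convMul_apply, l]
  simp only [Coalgebra.Repr.tmul_index, Coalgebra.Repr.tmul_left, Coalgebra.Repr.tmul_right,
    pullback_apply, pr₁₂_tmul, mul₁₂_tmul, Finset.sum_product, map_smul, smul_eq_mul, hc,
    Finset.mul_sum]
  refine Finset.sum_congr rfl fun i _ => Finset.sum_congr rfl fun j _ =>
    Finset.sum_congr rfl fun l _ => ?_
  ring

variable (σ) in
/-- The right side `σ(b₁, c₁) σ(a, b₂ c₂)` of the cocycle condition is `σ(a, b · c)`. -/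
theorem pr₂₃_mul_mul₂₃_apply (a b c : A) :
    (pullback (pr₂₃ k A) σ * pullback (mul₂₃ k A) σ) ((a ⊗ₜ b) ⊗ₜ c) =
      σ (a ⊗ₜ twist σ b c) := by
  have ha (u : A) : σ (a ⊗ₜ u) = ∑ i ∈ (ℛ k a).index,
      counit (R := k) ((ℛ k a).left i) * σ ((ℛ k a).right i ⊗ₜ u) := by
    conv_lhs => rw [← sum_counit_smul (ℛ k a)]
    simp [TensorProduct.sum_tmul, ← TensorProduct.smul_tmul']
  have r : σ (a ⊗ₜ twist σ b c) = ∑ i ∈ (ℛ k b).index, ∑ j ∈ (ℛ k c).index,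
      σ ((ℛ k b).left i ⊗ₜ (ℛ k c).left j) *
        σ (a ⊗ₜ ((ℛ k b).right i * (ℛ k c).right j)) := by
    rw [twist_apply (ℛ k b) (ℛ k c)]
    simp [TensorProduct.tmul_sum]
  rw [(((ℛ k a).tmul (ℛ k b)).tmul (ℛ k c)).convMul_apply, r]
  simp only [Coalgebra.Repr.tmul_index, Coalgebra.Repr.tmul_left, Coalgebra.Repr.tmul_right,
    pullback_apply, pr₂₃_tmul, mul₂₃_tmul, Finset.sum_product, ← TensorProduct.smul_tmul',
    map_smul, smul_eq_mul, ha, Finset.mul_sum]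
  rw [Finset.sum_comm]
  refine Finset.sum_congr rfl fun i _ => ?_
  rw [Finset.sum_comm]
  refine Finset.sum_congr rfl fun j _ => Finset.sum_congr rfl fun l _ => ?_
  ring

/-- The cocycle condition says that the twisted product is associative, after application of
the counit. -/
theorem isLeftCocycle_iff :
    IsLeftCocycle σ ↔ ∀ a b c, σ (twist σ a b ⊗ₜ c) = σ (a ⊗ₜ twist σ b c) := by
  constructor
  · intro h a b c
    rw [← pr₁₂_mul_mul₁₂_apply, ← pr₂₃_mul_mul₂₃_apply]
    exact congr($h ((a ⊗ₜ b) ⊗ₜ c))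
  · intro h
    refine WithConv.ofConv_injective (TensorProduct.ext_threefold fun a b c => ?_)
    exact (pr₁₂_mul_mul₁₂_apply σ a b c).trans
      ((h a b c).trans (pr₂₃_mul_mul₂₃_apply σ a b c).symm)

theorem IsLazyCocycle.assoc (hσ : IsLazyCocycle σ) (a b c : A) :
    σ (twist σ a b ⊗ₜ c) = σ (a ⊗ₜ twist σ b c) :=
  isLeftCocycle_iff.1 hσ.cocycle a b c

end Twist

end LazyCohomology

namespace GroupDatum

open LazyCohomology

variable {k : Type*} [Field k] {G : Type*} [Group G] [Finite G] (𝔾 : GroupDatum k G)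

/-! ### Coordinates and comultiplication -/

theorem gauss_self (q : k) (n : ℕ) : gauss q n n = 1 := by
  induction n with
  | zero => rfl
  | succ n ih => rw [gauss_succ, ih, gauss_of_lt q _ _ (by omega)]; simp

/-- The `q`-binomial formula for `Δ(l xⁿ)`, with `q = χ(g)`. -/
theorem comul_of_mul_x_pow (l : G) (n : ℕ) :
    comul (R := k) (𝔾.of l * 𝔾.x ^ n) = ∑ j ∈ Finset.range (n + 1), gauss (𝔾.χ 𝔾.g : k) n j •
      ((𝔾.of l * 𝔾.x ^ j) ⊗ₜ[k] (𝔾.of (l * 𝔾.g ^ j) * 𝔾.x ^ (n - j))) := by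
  have hq : (1 ⊗ₜ 𝔾.x) * (𝔾.x ⊗ₜ 𝔾.of 𝔾.g) =
      (𝔾.χ 𝔾.g : k) • ((𝔾.x ⊗ₜ 𝔾.of 𝔾.g) * ((1 : 𝔾.A) ⊗ₜ[k] 𝔾.x)) := by
    simp only [Algebra.TensorProduct.tmul_mul_tmul, one_mul, mul_one, x_mul_of,
      TensorProduct.tmul_smul]
  rw [Bialgebra.comul_mul, Bialgebra.comul_pow, comul_of, comul_x, add_comm, add_pow_gauss hq,
    Finset.mul_sum]
  refine Finset.sum_congr rfl fun j _ => ?_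
  simp [Algebra.TensorProduct.tmul_pow, mul_assoc]

theorem convMul_of_mul_x_pow (f f' : WithConv (𝔾.A →ₗ[k] k)) (l : G) (n : ℕ) :
    (f * f') (𝔾.of l * 𝔾.x ^ n) = ∑ j ∈ Finset.range (n + 1), gauss (𝔾.χ 𝔾.g : k) n j *
      (f (𝔾.of l * 𝔾.x ^ j) * f' (𝔾.of (l * 𝔾.g ^ j) * 𝔾.x ^ (n - j))) := by
  rw [LinearMap.convMul_apply, comul_of_mul_x_pow]
  simp only [map_sum, map_smul, TensorProduct.map_tmul, LinearMap.mul'_apply, smul_eq_mul]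

open Classical in
/-- The coordinate of the monomial `m xⁱ`. -/
def coord (m : G) (i : ℕ) : 𝔾.A →ₗ[k] k :=
  (𝔾.exists_form fun l n => if l = m ∧ n = i then 1 else 0).choose

open Classical in
theorem coord_monomial (m : G) (i : ℕ) (l : G) {n : ℕ} (hn : n < 𝔾.d) :
    𝔾.coord m i (𝔾.of l * 𝔾.x ^ n) = if l = m ∧ n = i then 1 else 0 :=
  (𝔾.exists_form fun l n => if l = m ∧ n = i then 1 else 0).choose_spec l n hn

theorem coord_of_mul (m h : G) (i : ℕ) (y : 𝔾.A) :
    𝔾.coord m i (𝔾.of h * y) = 𝔾.coord (h⁻¹ * m) i y := by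
  have := 𝔾.linearMap_ext (f := 𝔾.coord m i ∘ₗ LinearMap.mulLeft k (𝔾.of h))
    (f' := 𝔾.coord (h⁻¹ * m) i) (fun l n hn => by
      simp only [LinearMap.comp_apply, LinearMap.mulLeft_apply]
      rw [← mul_assoc, ← map_mul, 𝔾.coord_monomial _ _ _ hn, 𝔾.coord_monomial _ _ _ hn]
      rw [eq_inv_mul_iff_mul_eq])
  exact congr($this y)

theorem coord_mul_of (m h : G) (y : 𝔾.A) :
    𝔾.coord m 0 (y * 𝔾.of h) = 𝔾.coord (m * h⁻¹) 0 y := by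
  have := 𝔾.linearMap_ext (f := 𝔾.coord m 0 ∘ₗ LinearMap.mulRight k (𝔾.of h))
    (f' := 𝔾.coord (m * h⁻¹) 0) (fun l n hn => by
      simp only [LinearMap.comp_apply, LinearMap.mulRight_apply, mul_assoc,
        pow_mul_of 𝔾.x_mul_of, mul_smul_comm, map_smul]
      rw [← mul_assoc, ← map_mul, 𝔾.coord_monomial _ _ _ hn, 𝔾.coord_monomial _ _ _ hn]
      rw [eq_mul_inv_iff_mul_eq]
      split_ifs with h0 <;> simp [h0])
  exact congr($this y)

open Classical in
/-- Convolution on the right with the coordinate of `m` cuts out the part of degree `m` for the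
right grading, in which `l xⁿ` has degree `l gⁿ`. -/
theorem convMul_coord (f : WithConv (𝔾.A →ₗ[k] k)) (m l : G) {n : ℕ} (hn : n < 𝔾.d) :
    (f * toConv (𝔾.coord m 0)) (𝔾.of l * 𝔾.x ^ n) =
      if l * 𝔾.g ^ n = m then f (𝔾.of l * 𝔾.x ^ n) else 0 := by
  rw [convMul_of_mul_x_pow, Finset.sum_eq_single_of_mem n (by simp)]
  · change _ * (_ * 𝔾.coord m 0 _) = _
    rw [𝔾.coord_monomial _ _ _ (by omega), gauss_self]
    simp
  · intro j hj hjn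
    rw [Finset.mem_range] at hj
    change _ * (_ * 𝔾.coord m 0 _) = _
    rw [𝔾.coord_monomial _ _ _ (by omega), if_neg (by omega)]
    simp

open Classical in
/-- Convolution on the left with the coordinate of `m` cuts out the part of degree `m` for the
left grading, in which `l xⁿ` has degree `l`. -/
theorem coord_convMul (f : WithConv (𝔾.A →ₗ[k] k)) (m l : G) {n : ℕ} (hn : n < 𝔾.d) :
    (toConv (𝔾.coord m 0) * f) (𝔾.of l * 𝔾.x ^ n) =
      if l = m then f (𝔾.of l * 𝔾.x ^ n) else 0 := by
  rw [convMul_of_mul_x_pow, Finset.sum_eq_single_of_mem 0 (by simp)]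
  · change _ * (𝔾.coord m 0 _ * _) = _
    rw [𝔾.coord_monomial _ _ _ (by omega), gauss_zero]
    simp
  · intro j hj hjn
    rw [Finset.mem_range] at hj
    change _ * (𝔾.coord m 0 _ * _) = _
    rw [𝔾.coord_monomial _ _ _ (by omega), if_neg (by omega)]
    simp

end GroupDatum

namespace GroupDatum

open LazyCohomology

variable {k : Type*} [Field k] {G : Type*} [Group G] [Finite G] (𝔾 : GroupDatum k G)

/-! ### Values of a lazy cocycle on generators -/

theorem one_lt_d : 1 < 𝔾.d := by
  have h1 := 𝔾.d_pos
  have h2 : 𝔾.d ≠ 1 := fun h => 𝔾.χ_g_ne_one (orderOf_eq_one_iff.1 h)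
  omega

theorem g_pow_ne_one {n : ℕ} (h0 : n ≠ 0) (hn : n < 𝔾.d) : 𝔾.g ^ n ≠ 1 := by
  intro h
  have : 𝔾.χ 𝔾.g ^ n = 1 := by rw [← map_pow, h, map_one]
  exact pow_ne_one_of_lt_orderOf h0 hn this

/-- The representation `Δ(h) = h ⊗ h`. -/
def reprOf (h : G) : Coalgebra.Repr k (𝔾.of h) Unit where
  index := {()}
  left _ := 𝔾.of h
  right _ := 𝔾.of h
  eq := by simp

/-- The representation `Δ(x) = 1 ⊗ x + x ⊗ g`. -/
def reprX : Coalgebra.Repr k 𝔾.x Bool where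
  index := Finset.univ
  left b := if b then 1 else 𝔾.x
  right b := if b then 𝔾.x else 𝔾.of 𝔾.g
  eq := by simp

theorem counit_monomial (l : G) (n : ℕ) :
    counit (R := k) (𝔾.of l * 𝔾.x ^ n) = if n = 0 then 1 else 0 := by
  rw [Bialgebra.counit_mul, Bialgebra.counit_pow, counit_of, counit_x, one_mul, zero_pow_eq]

/-- The left and right degrees `l` and `l gⁿ` of `l xⁿ` differ unless `gⁿ = 1`, so a form that
commutes with the coordinate of `l` vanishes at `l xⁿ`. -/
theorem eq_zero_of_commute_coord {f : WithConv (𝔾.A →ₗ[k] k)} {l : G} {n : ℕ} (hn : n < 𝔾.d)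
    (hf : Commute f (toConv (𝔾.coord l 0))) (hg : 𝔾.g ^ n ≠ 1) :
    f (𝔾.of l * 𝔾.x ^ n) = 0 := by
  have h := congr($(hf.eq) (𝔾.of l * 𝔾.x ^ n))
  rw [𝔾.convMul_coord _ _ _ hn, 𝔾.coord_convMul _ _ _ hn, if_pos rfl, if_neg (by simpa)] at h
  exact h.symm

variable {𝔾} {σ τ : WithConv (𝔾.A ⊗[k] 𝔾.A →ₗ[k] k)}

section Twist

variable {y : 𝔾.A} {ι : Type*} (r : Coalgebra.Repr k y ι)

theorem of_twist (h : G) : twist σ (𝔾.of h) y =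
    ∑ j ∈ r.index, σ (𝔾.of h ⊗ₜ r.left j) • (𝔾.of h * r.right j) := by
  rw [twist_apply (𝔾.reprOf h) r]
  simp [reprOf]

theorem of_twist' (hσ : IsLazyCocycle σ) (h : G) : twist σ (𝔾.of h) y =
    ∑ j ∈ r.index, σ (𝔾.of h ⊗ₜ r.right j) • (𝔾.of h * r.left j) := by
  rw [hσ.twist_apply' (𝔾.reprOf h) r]
  simp [reprOf]

theorem twist_of (h : G) : twist σ y (𝔾.of h) =
    ∑ j ∈ r.index, σ (r.left j ⊗ₜ 𝔾.of h) • (r.right j * 𝔾.of h) := by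
  rw [twist_apply r (𝔾.reprOf h)]
  simp [reprOf]

theorem twist_of' (hσ : IsLazyCocycle σ) (h : G) : twist σ y (𝔾.of h) =
    ∑ j ∈ r.index, σ (r.right j ⊗ₜ 𝔾.of h) • (r.left j * 𝔾.of h) := by
  rw [hσ.twist_apply' r (𝔾.reprOf h)]
  simp [reprOf]

theorem x_twist (hσ : IsLazyCocycle σ) : twist σ 𝔾.x y =
    𝔾.x * y + ∑ j ∈ r.index, σ (𝔾.x ⊗ₜ r.left j) • (𝔾.of 𝔾.g * r.right j) := by
  rw [twist_apply 𝔾.reprX r]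
  have e := congr(𝔾.x * $(sum_counit_smul r))
  rw [Finset.mul_sum] at e
  simp only [mul_smul_comm] at e
  simp [reprX, (hσ.normalized _).2, e]

theorem x_twist' (hσ : IsLazyCocycle σ) : twist σ 𝔾.x y =
    ∑ j ∈ r.index, σ (𝔾.x ⊗ₜ r.right j) • r.left j +
      ∑ j ∈ r.index, σ (𝔾.of 𝔾.g ⊗ₜ r.right j) • (𝔾.x * r.left j) := by
  rw [hσ.twist_apply' 𝔾.reprX r]
  simp [reprX]

theorem twist_x (hσ : IsLazyCocycle σ) : twist σ y 𝔾.x =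
    y * 𝔾.x + ∑ j ∈ r.index, σ (r.left j ⊗ₜ 𝔾.x) • (r.right j * 𝔾.of 𝔾.g) := by
  rw [twist_apply r 𝔾.reprX]
  have e := congr($(sum_counit_smul r) * 𝔾.x)
  rw [Finset.sum_mul] at e
  simp only [smul_mul_assoc] at e
  simp [reprX, (hσ.normalized _).1, Finset.sum_add_distrib, e]

theorem twist_x' (hσ : IsLazyCocycle σ) : twist σ y 𝔾.x =
    ∑ j ∈ r.index, σ (r.right j ⊗ₜ 𝔾.x) • r.left j +
      ∑ j ∈ r.index, σ (r.right j ⊗ₜ 𝔾.of 𝔾.g) • (r.left j * 𝔾.x) := by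
  rw [hσ.twist_apply' r 𝔾.reprX]
  simp [reprX, Finset.sum_add_distrib]

end Twist

/-- Laziness at `(h, y)`, multiplied by `h⁻¹`, says that `σ(h, ·)` is central. -/
theorem commute_evalLeft_of (hσ : IsLazyCocycle σ) (h : G) (φ : WithConv (𝔾.A →ₗ[k] k)) :
    Commute (evalLeft σ (𝔾.of h)) φ := by
  ext y
  have e := congr(φ (𝔾.of h⁻¹ * $((of_twist (ℛ k y) h).symm.trans (of_twist' (ℛ k y) hσ h))))
  rw [(ℛ k y).convMul_apply, (ℛ k y).convMul_apply]
  simpa [Finset.mul_sum, ← mul_assoc, ← map_mul, mul_comm] using e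

/-- Laziness at `(y, h)`, multiplied by `h⁻¹`, says that `σ(·, h)` is central. -/
theorem commute_evalRight_of (hσ : IsLazyCocycle σ) (h : G) (φ : WithConv (𝔾.A →ₗ[k] k)) :
    Commute (evalRight σ (𝔾.of h)) φ := by
  ext y
  have e := congr(φ ($((twist_of (ℛ k y) h).symm.trans (twist_of' (ℛ k y) hσ h)) * 𝔾.of h⁻¹))
  rw [(ℛ k y).convMul_apply, (ℛ k y).convMul_apply]
  simpa [Finset.sum_mul, mul_assoc, ← map_mul, mul_comm] using e

theorem apply_of_monomial (hσ : IsLazyCocycle σ) (h l : G) {n : ℕ} (h0 : n ≠ 0) (hn : n < 𝔾.d) :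
    σ (𝔾.of h ⊗ₜ (𝔾.of l * 𝔾.x ^ n)) = 0 :=
  𝔾.eq_zero_of_commute_coord hn (commute_evalLeft_of hσ h _) (𝔾.g_pow_ne_one h0 hn)

theorem apply_monomial_of (hσ : IsLazyCocycle σ) (h l : G) {n : ℕ} (h0 : n ≠ 0) (hn : n < 𝔾.d) :
    σ ((𝔾.of l * 𝔾.x ^ n) ⊗ₜ 𝔾.of h) = 0 :=
  𝔾.eq_zero_of_commute_coord hn (commute_evalRight_of hσ h _) (𝔾.g_pow_ne_one h0 hn)

/-- Compare the coefficients of `l x` in the two expressions for the twisted product of `x`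
and `l`. -/
theorem apply_g_of (hσ : IsLazyCocycle σ) (l : G) : σ (𝔾.of 𝔾.g ⊗ₜ 𝔾.of l) = 1 := by
  have e := congr(𝔾.coord l 1
    $((x_twist (𝔾.reprOf l) hσ).symm.trans (x_twist' (𝔾.reprOf l) hσ)))
  have h1 := 𝔾.coord_monomial l 1 l 𝔾.one_lt_d
  have h2 := 𝔾.coord_monomial l 1 l 𝔾.d_pos
  have h3 := 𝔾.coord_monomial l 1 (𝔾.g * l) 𝔾.d_pos
  simp only [pow_one, pow_zero, mul_one, and_true, if_true, zero_ne_one, and_false, if_false]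
    at h1 h2 h3
  simp [reprOf, x_mul_of, ← map_mul, h1, h2, h3] at e
  exact e

theorem apply_of_g (hσ : IsLazyCocycle σ) (l : G) : σ (𝔾.of l ⊗ₜ 𝔾.of 𝔾.g) = 1 := by
  have e := congr(𝔾.coord l 1
    $((twist_x (𝔾.reprOf l) hσ).symm.trans (twist_x' (𝔾.reprOf l) hσ)))
  have h1 := 𝔾.coord_monomial l 1 l 𝔾.one_lt_d
  have h2 := 𝔾.coord_monomial l 1 l 𝔾.d_pos
  have h3 := 𝔾.coord_monomial l 1 (l * 𝔾.g) 𝔾.d_pos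
  simp only [pow_one, pow_zero, mul_one, and_true, if_true, zero_ne_one, and_false, if_false]
    at h1 h2 h3
  simp [reprOf, ← map_mul, h1, h2, h3] at e
  exact e.symm

theorem apply_g (hσ : IsLazyCocycle σ) (y : 𝔾.A) :
    σ (𝔾.of 𝔾.g ⊗ₜ y) = counit (R := k) y := by
  have := 𝔾.linearMap_ext (f := (evalLeft σ (𝔾.of 𝔾.g)).ofConv) (f' := counit) fun l n hn => by
    rw [counit_monomial]
    split_ifs with h0
    · subst h0
      simpa using apply_g_of hσ l
    · exact apply_of_monomial hσ _ _ h0 hn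
  exact congr($this y)

theorem apply_g' (hσ : IsLazyCocycle σ) (y : 𝔾.A) :
    σ (y ⊗ₜ 𝔾.of 𝔾.g) = counit (R := k) y := by
  have := 𝔾.linearMap_ext (f := (evalRight σ (𝔾.of 𝔾.g)).ofConv) (f' := counit) fun l n hn => by
    rw [counit_monomial]
    split_ifs with h0
    · subst h0
      simpa using apply_of_g hσ l
    · exact apply_monomial_of hσ _ _ h0 hn
  exact congr($this y)

theorem sum_smul_counit {y : 𝔾.A} {ι : Type*} (r : Coalgebra.Repr k y ι) :
    ∑ j ∈ r.index, counit (R := k) (r.right j) • r.left j = y := by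
  have e := congr(TensorProduct.rid k 𝔾.A $(sum_tmul_counit_eq r))
  simp only [map_sum, TensorProduct.rid_tmul, one_smul] at e
  exact e

/-- Laziness at `(x, y)`, after cancelling `x y`. -/
theorem sum_apply_x (hσ : IsLazyCocycle σ) {y : 𝔾.A} {ι : Type*} (r : Coalgebra.Repr k y ι) :
    ∑ j ∈ r.index, σ (𝔾.x ⊗ₜ r.left j) • (𝔾.of 𝔾.g * r.right j) =
      ∑ j ∈ r.index, σ (𝔾.x ⊗ₜ r.right j) • r.left j := by
  have e := (x_twist r hσ).symm.trans (x_twist' r hσ)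
  have e' := congr(𝔾.x * $(sum_smul_counit r))
  simp only [Finset.mul_sum, mul_smul_comm] at e'
  simp only [apply_g hσ, e'] at e
  rw [add_comm] at e
  exact add_right_cancel e

/-- Laziness at `(y, x)`, after cancelling `y x`. -/
theorem sum_apply_x' (hσ : IsLazyCocycle σ) {y : 𝔾.A} {ι : Type*} (r : Coalgebra.Repr k y ι) :
    ∑ j ∈ r.index, σ (r.left j ⊗ₜ 𝔾.x) • (r.right j * 𝔾.of 𝔾.g) =
      ∑ j ∈ r.index, σ (r.right j ⊗ₜ 𝔾.x) • r.left j := by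
  have e := (twist_x r hσ).symm.trans (twist_x' r hσ)
  have e' := congr($(sum_smul_counit r) * 𝔾.x)
  simp only [Finset.sum_mul, smul_mul_assoc] at e'
  simp only [apply_g' hσ, e'] at e
  rw [add_comm] at e
  exact add_right_cancel e

theorem apply_x_monomial (hσ : IsLazyCocycle σ) (l : G) {n : ℕ} (hn : n < 𝔾.d)
    (hg : 𝔾.g ^ (n + 1) ≠ 1) : σ (𝔾.x ⊗ₜ (𝔾.of l * 𝔾.x ^ n)) = 0 := by
  have e : (evalLeft σ 𝔾.x * toConv (𝔾.coord (𝔾.g⁻¹ * l) 0)) (𝔾.of l * 𝔾.x ^ n) =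
      (toConv (𝔾.coord l 0) * evalLeft σ 𝔾.x) (𝔾.of l * 𝔾.x ^ n) := by
    have := congr(𝔾.coord l 0 $(sum_apply_x hσ (ℛ k (𝔾.of l * 𝔾.x ^ n))))
    rw [(ℛ k _).convMul_apply, (ℛ k _).convMul_apply]
    simpa [coord_of_mul, mul_comm] using this
  rw [𝔾.convMul_coord _ _ _ hn, 𝔾.coord_convMul _ _ _ hn, if_pos rfl, if_neg] at e
  · exact e.symm
  · intro h
    rw [eq_inv_mul_iff_mul_eq, ← mul_assoc, ← comm_g, mul_assoc, ← pow_succ'] at h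
    exact hg (by simpa using h)

theorem apply_monomial_x (hσ : IsLazyCocycle σ) (l : G) {n : ℕ} (hn : n < 𝔾.d)
    (hg : 𝔾.g ^ (n + 1) ≠ 1) : σ ((𝔾.of l * 𝔾.x ^ n) ⊗ₜ 𝔾.x) = 0 := by
  have e : (evalRight σ 𝔾.x * toConv (𝔾.coord (l * 𝔾.g⁻¹) 0)) (𝔾.of l * 𝔾.x ^ n) =
      (toConv (𝔾.coord l 0) * evalRight σ 𝔾.x) (𝔾.of l * 𝔾.x ^ n) := by
    have := congr(𝔾.coord l 0 $(sum_apply_x' hσ (ℛ k (𝔾.of l * 𝔾.x ^ n))))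
    rw [(ℛ k _).convMul_apply, (ℛ k _).convMul_apply]
    simpa [coord_mul_of, mul_comm] using this
  rw [𝔾.convMul_coord _ _ _ hn, 𝔾.coord_convMul _ _ _ hn, if_pos rfl, if_neg] at e
  · exact e.symm
  · intro h
    rw [eq_mul_inv_iff_mul_eq, mul_assoc, ← pow_succ] at h
    exact hg (by simpa using h)

/-! ### The parameter of a lazy cocycle -/

variable (𝔾) in
/-- The parameter `s = σ(x, x ^ (d - 1))` of a lazy cocycle. -/
def param (σ : WithConv (𝔾.A ⊗[k] 𝔾.A →ₗ[k] k)) : k := σ (𝔾.x ⊗ₜ (𝔾.x ^ (𝔾.d - 1)))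

/-- The parameter vanishes unless `g ^ d = 1`, by the degree argument of `apply_x_monomial`. -/
theorem g_pow_d_of_param_ne_zero (hσ : IsLazyCocycle σ) (hs : 𝔾.param σ ≠ 0) :
    𝔾.g ^ 𝔾.d = 1 := by
  have hd := 𝔾.d_pos
  by_contra h
  refine hs ?_
  simpa [param] using apply_x_monomial hσ 1 (n := 𝔾.d - 1) (by omega)
    (by rwa [Nat.sub_add_cancel hd])

/-- `Δ(xⁿ)` is a combination of the `xʲ ⊗ gʲ xⁿ⁻ʲ`. -/
def reprXPow (n : ℕ) : Coalgebra.Repr k (𝔾.x ^ n) ℕ where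
  index := Finset.range (n + 1)
  left j := 𝔾.x ^ j
  right j := gauss (𝔾.χ 𝔾.g : k) n j • (𝔾.of (𝔾.g ^ j) * 𝔾.x ^ (n - j))
  eq := by simpa using (𝔾.comul_of_mul_x_pow 1 n).symm

/-- In the twisted algebra, `x · x ^ (d - 1)` differs from `x ^ d` by a multiple of the
parameter. -/
theorem x_twist_x_pow (hσ : IsLazyCocycle σ) :
    twist σ 𝔾.x (𝔾.x ^ (𝔾.d - 1)) = 𝔾.x ^ 𝔾.d + 𝔾.param σ • 𝔾.of (𝔾.g ^ 𝔾.d) := by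
  have hd := 𝔾.d_pos
  rw [x_twist (𝔾.reprXPow _) hσ, ← pow_succ', Nat.sub_add_cancel hd]
  congr 1
  refine (Finset.sum_eq_single_of_mem (𝔾.d - 1) (by simp [reprXPow]) fun j hj hj' => ?_).trans ?_
  · simp only [reprXPow, Finset.mem_range] at hj ⊢
    have := apply_x_monomial hσ 1 (n := j) (by omega) (𝔾.g_pow_ne_one (by omega) (by omega))
    simp only [map_one, one_mul] at this
    rw [this, zero_smul]
  · simp [reprXPow, gauss_self, param, ← pow_succ', Nat.sub_add_cancel hd]

theorem of_twist_monomial (hσ : IsLazyCocycle σ) (h : G) {n : ℕ} (hn : n < 𝔾.d) :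
    twist σ (𝔾.of h) (𝔾.x ^ n) = 𝔾.of h * 𝔾.x ^ n := by
  have e : 0 ∈ (𝔾.reprXPow n).index := by simp [reprXPow]
  rw [of_twist (𝔾.reprXPow n), Finset.sum_eq_single_of_mem 0 e fun j hj hj' => ?_]
  · simp [reprXPow, gauss_zero, (hσ.normalized _).1]
  · simp only [reprXPow, Finset.mem_range] at hj ⊢
    have := apply_of_monomial hσ h 1 hj' (by omega)
    simp only [map_one, one_mul] at this
    rw [this, zero_smul]

theorem twist_monomial_of (hσ : IsLazyCocycle σ) (h : G) {n : ℕ} (hn : n < 𝔾.d) :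
    twist σ (𝔾.x ^ n) (𝔾.of h) = 𝔾.x ^ n * 𝔾.of h := by
  have e : 0 ∈ (𝔾.reprXPow n).index := by simp [reprXPow]
  rw [twist_of (𝔾.reprXPow n), Finset.sum_eq_single_of_mem 0 e fun j hj hj' => ?_]
  · simp [reprXPow, gauss_zero, (hσ.normalized _).2]
  · simp only [reprXPow, Finset.mem_range] at hj ⊢
    have := apply_monomial_of hσ h 1 hj' (by omega)
    simp only [map_one, one_mul] at this
    rw [this, zero_smul]

theorem twist_monomial_x (hσ : IsLazyCocycle σ) {n : ℕ} (hn : n + 1 < 𝔾.d) :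
    twist σ (𝔾.x ^ n) 𝔾.x = 𝔾.x ^ (n + 1) := by
  rw [twist_x (𝔾.reprXPow n) hσ, Finset.sum_eq_zero fun j hj => ?_, add_zero, pow_succ]
  simp only [reprXPow, Finset.mem_range] at hj ⊢
  have := apply_monomial_x hσ 1 (n := j) (by omega) (𝔾.g_pow_ne_one (by omega) (by omega))
  simp only [map_one, one_mul] at this
  rw [this, zero_smul]

/-- On `G`, a lazy cocycle depends only on the classes modulo `⟨g⟩`. -/
theorem apply_of_g_pow (hσ : IsLazyCocycle σ) (h l : G) (n : ℕ) :
    σ (𝔾.of h ⊗ₜ 𝔾.of (l * 𝔾.g ^ n)) = σ (𝔾.of h ⊗ₜ 𝔾.of l) := by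
  induction n with
  | zero => simp
  | succ n ih =>
    have e := hσ.assoc (𝔾.of h) (𝔾.of (l * 𝔾.g ^ n)) (𝔾.of 𝔾.g)
    rw [of_twist (𝔾.reprOf _), of_twist (𝔾.reprOf _)] at e
    simp only [reprOf, Finset.sum_singleton, apply_of_g hσ, one_smul, ← map_mul, mul_assoc,
      ← pow_succ, ← TensorProduct.smul_tmul', map_smul, smul_eq_mul, mul_one] at e
    rw [← e, ih]

theorem apply_g_pow_of (hσ : IsLazyCocycle σ) (h l : G) (n : ℕ) :
    σ (𝔾.of (h * 𝔾.g ^ n) ⊗ₜ 𝔾.of l) = σ (𝔾.of h ⊗ₜ 𝔾.of l) := by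
  induction n with
  | zero => simp
  | succ n ih =>
    have e := hσ.assoc (𝔾.of 𝔾.g) (𝔾.of (h * 𝔾.g ^ n)) (𝔾.of l)
    rw [of_twist (𝔾.reprOf _), of_twist (𝔾.reprOf _)] at e
    simp only [reprOf, Finset.sum_singleton, apply_g_of hσ, one_smul, ← map_mul, ← mul_assoc,
      TensorProduct.tmul_smul, map_smul, smul_eq_mul, mul_one] at e
    rw [← comm_g, mul_assoc, ← comm_g, ← pow_succ, ih] at e
    exact e

/-- `σ(l, x · x ^ (d - 1)) = s` for the product twisted by `σ`. -/
theorem apply_x_twist (hσ : IsLazyCocycle σ) (l : G) :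
    σ (𝔾.of l ⊗ₜ twist σ 𝔾.x (𝔾.x ^ (𝔾.d - 1))) = 𝔾.param σ := by
  have h1 := apply_of_g_pow hσ l 1 𝔾.d
  have h2 := (hσ.normalized (𝔾.of l)).1
  rw [one_mul, map_one, h2] at h1
  rw [x_twist_x_pow hσ, x_pow, TensorProduct.tmul_add, TensorProduct.tmul_smul,
    TensorProduct.tmul_smul, TensorProduct.tmul_sub, map_add, map_smul, map_smul, map_sub, h1, h2]
  simp

theorem apply_x_twist' (hσ : IsLazyCocycle σ) (l : G) :
    σ (twist σ 𝔾.x (𝔾.x ^ (𝔾.d - 1)) ⊗ₜ 𝔾.of l) = 𝔾.param σ := by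
  have h1 := apply_g_pow_of hσ 1 l 𝔾.d
  have h2 := (hσ.normalized (𝔾.of l)).2
  rw [one_mul, map_one, h2] at h1
  rw [x_twist_x_pow hσ, x_pow, TensorProduct.add_tmul, ← TensorProduct.smul_tmul',
    ← TensorProduct.smul_tmul', TensorProduct.sub_tmul, map_add, map_smul, map_smul, map_sub, h1,
    h2]
  simp

/-- The values `σ(x, l x ^ (d - 1))` are determined by the parameter. To see this, write
`l x ^ (d - 1)` as a twisted product and move `l` to the left, past `x`. -/
theorem apply_x_top (hσ : IsLazyCocycle σ) (l : G) :
    σ (𝔾.x ⊗ₜ (𝔾.of l * 𝔾.x ^ (𝔾.d - 1))) = 𝔾.χ l * 𝔾.param σ := by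
  have hd := 𝔾.one_lt_d
  have e := twist_monomial_of hσ l (n := 1) hd
  rw [pow_one] at e
  have e' := of_twist_monomial hσ l (n := 1) hd
  rw [pow_one] at e'
  rw [← of_twist_monomial hσ l (by omega), ← hσ.assoc, e, x_mul_of, ← TensorProduct.smul_tmul',
    map_smul, ← e', hσ.assoc, apply_x_twist hσ, smul_eq_mul]

/-- A lazy cocycle with nonzero parameter exists only in type I. That `g ^ d = 1` is
`g_pow_d_of_param_ne_zero`; that `χ ^ d = 1` follows from associativity of the twisted product of
`x`, `x ^ (d - 1)` and `l ∈ G`. -/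
theorem isTypeI_of_param_ne_zero (hσ : IsLazyCocycle σ) (hs : 𝔾.param σ ≠ 0) : 𝔾.IsTypeI := by
  have hd := 𝔾.d_pos
  have hg := g_pow_d_of_param_ne_zero hσ hs
  have ho : 𝔾.d = orderOf 𝔾.g := Nat.dvd_antisymm
    (orderOf_map_dvd 𝔾.χ 𝔾.g) (orderOf_dvd_of_pow_eq_one hg)
  refine ⟨𝔾.μ_eq_zero ho.symm, ho, ?_⟩
  ext l
  have e := hσ.assoc 𝔾.x (𝔾.x ^ (𝔾.d - 1)) (𝔾.of l)
  rw [apply_x_twist' hσ, twist_monomial_of hσ l (by omega), pow_mul_of 𝔾.x_mul_of,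
    TensorProduct.tmul_smul, map_smul, apply_x_top hσ, smul_eq_mul, ← mul_assoc, ← pow_succ,
    Nat.sub_add_cancel hd] at e
  simpa using (mul_right_cancel₀ hs ((one_mul _).trans e)).symm

/-- A lazy cocycle is determined by its restriction to `G` and its parameter. These determine the
forms `σ(h, ·)` and `σ(x, ·)`, hence twisted products with left factor `h` or `x`, and then
`σ(a · b, c) = σ(a, b · c)` determines `σ(xⁿ l, ·)` by induction on `n`. -/
theorem eq_of_apply_of (hσ : IsLazyCocycle σ) (hτ : IsLazyCocycle τ)
    (hG : ∀ h l, σ (𝔾.of h ⊗ₜ 𝔾.of l) = τ (𝔾.of h ⊗ₜ 𝔾.of l)) (hp : 𝔾.param σ = 𝔾.param τ) :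
    σ = τ := by
  have hd := 𝔾.d_pos
  have h1 : ∀ h y, σ (𝔾.of h ⊗ₜ y) = τ (𝔾.of h ⊗ₜ y) := by
    intro h y
    have := 𝔾.linearMap_ext (f := (evalLeft σ (𝔾.of h)).ofConv)
      (f' := (evalLeft τ (𝔾.of h)).ofConv) fun l n hn => by
        by_cases h0 : n = 0
        · subst h0
          simpa using hG h l
        · exact (apply_of_monomial hσ _ _ h0 hn).trans (apply_of_monomial hτ _ _ h0 hn).symm
    exact congr($this y)
  have h2 : ∀ y, σ (𝔾.x ⊗ₜ y) = τ (𝔾.x ⊗ₜ y) := by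
    intro y
    have := 𝔾.linearMap_ext (f := (evalLeft σ 𝔾.x).ofConv) (f' := (evalLeft τ 𝔾.x).ofConv)
      fun l n hn => by
        change σ (𝔾.x ⊗ₜ _) = τ (𝔾.x ⊗ₜ _)
        by_cases h0 : n + 1 = 𝔾.d
        · obtain rfl : n = 𝔾.d - 1 := by omega
          rw [apply_x_top hσ, apply_x_top hτ, hp]
        · have hg := 𝔾.g_pow_ne_one (n := n + 1) (by omega) (by omega)
          rw [apply_x_monomial hσ _ hn hg, apply_x_monomial hτ _ hn hg]
    exact congr($this y)
  have t1 : ∀ h y, twist σ (𝔾.of h) y = twist τ (𝔾.of h) y := by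
    intro h y
    rw [of_twist (ℛ k y), of_twist (ℛ k y)]
    simp only [h1]
  have t2 : ∀ y, twist σ 𝔾.x y = twist τ 𝔾.x y := by
    intro y
    rw [x_twist (ℛ k y) hσ, x_twist (ℛ k y) hτ]
    simp only [h2]
  have h3 : ∀ n < 𝔾.d, ∀ y, σ ((𝔾.x ^ n) ⊗ₜ y) = τ ((𝔾.x ^ n) ⊗ₜ y) := by
    intro n
    induction n with
    | zero =>
      intro _ y
      rw [pow_zero, (hσ.normalized y).2, (hτ.normalized y).2]
    | succ n ih =>
      intro hn y
      rw [← twist_monomial_x hσ hn, hσ.assoc, ih (by omega), t2, ← hτ.assoc,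
        twist_monomial_x hσ hn, twist_monomial_x hτ hn]
  ext a b
  have := 𝔾.linearMap_ext (f := (evalRight σ b).ofConv) (f' := (evalRight τ b).ofConv)
    fun l n hn => by
      change σ (_ ⊗ₜ b) = τ (_ ⊗ₜ b)
      have e : 𝔾.of l * 𝔾.x ^ n = ((𝔾.χ l : k) ^ n)⁻¹ • (𝔾.x ^ n * 𝔾.of l) := by
        rw [pow_mul_of 𝔾.x_mul_of, inv_smul_smul₀ (pow_ne_zero _ (Units.ne_zero _))]
      rw [e, ← TensorProduct.smul_tmul', map_smul, map_smul]
      congr 1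
      rw [← twist_monomial_of hσ l hn, hσ.assoc, h3 n hn, t1, ← hτ.assoc,
        twist_monomial_of hσ l hn, twist_monomial_of hτ l hn]
  exact congr($this a)

/-- The parameter is additive, since `Δ(x) = 1 ⊗ x + x ⊗ g` and `σ(1, ·) = ε = τ(g, ·)`. -/
theorem param_mul (hσ : IsLazyCocycle σ) (hτ : IsLazyCocycle τ) :
    𝔾.param (σ * τ) = 𝔾.param σ + 𝔾.param τ := by
  have r := ℛ k (𝔾.x ^ (𝔾.d - 1))
  have e1 := congr(σ (𝔾.x ⊗ₜ $(sum_smul_counit r)))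
  have e2 := congr(τ (𝔾.x ⊗ₜ $(sum_counit_smul r)))
  simp only [TensorProduct.tmul_sum, TensorProduct.tmul_smul, map_sum, map_smul, smul_eq_mul]
    at e1 e2
  rw [param, (𝔾.reprX.tmul r).convMul_apply]
  simp [reprX, Finset.sum_product, (hσ.normalized _).2, apply_g hτ, param, e2,
    mul_comm _ (counit _), e1, add_comm]

end GroupDatum

namespace LazyCohomology

/-! ### Evaluation at group-like elements -/

section GroupLike

variable {k : Type*} [CommRing k]

theorem IsGroupLikeElem.tmul {C D : Type*} [AddCommMonoid C] [Module k C] [Coalgebra k C]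
    [AddCommMonoid D] [Module k D] [Coalgebra k D] {a : C} {b : D} (ha : IsGroupLikeElem k a)
    (hb : IsGroupLikeElem k b) : IsGroupLikeElem k (a ⊗ₜ[k] b) where
  counit_eq_one := by simp [ha.counit_eq_one, hb.counit_eq_one]
  comul_eq_tmul_self := by
    simp [TensorProduct.comul_tmul, ha.comul_eq_tmul_self, hb.comul_eq_tmul_self]

/-- Evaluation at a group-like element is multiplicative for the convolution product. -/
def evalGroupLike {C : Type*} [AddCommMonoid C] [Module k C] [Coalgebra k C] {a : C}
    (ha : IsGroupLikeElem k a) : WithConv (C →ₗ[k] k) →* k where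
  toFun f := f a
  map_one' := by simp [ha.counit_eq_one]
  map_mul' f g := by simp [ha.comul_eq_tmul_self]

theorem evalGroupLike_apply {C : Type*} [AddCommMonoid C] [Module k C] [Coalgebra k C] {a : C}
    (ha : IsGroupLikeElem k a) (f : WithConv (C →ₗ[k] k)) : evalGroupLike ha f = f a := rfl

end GroupLike

/-! ### Cocycles pulled back along a cocentral bialgebra map -/

section Pullback

variable {k : Type*} [CommRing k] {A : Type*} [Ring A] [HopfAlgebra k A]
  {H : Type*} [Ring H] [HopfAlgebra k H] (π : A →ₐc[k] H)

/-- The square `π ⊗ π` of a bialgebra map, as a coalgebra map. -/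
def tensorSquare : A ⊗[k] A →ₗc[k] H ⊗[k] H :=
  Coalgebra.TensorProduct.map (π : A →ₗc[k] H) (π : A →ₗc[k] H)

@[simp] theorem tensorSquare_tmul (a b : A) : tensorSquare π (a ⊗ₜ b) = π a ⊗ₜ[k] π b := rfl

variable {π} {σ : WithConv (H ⊗[k] H →ₗ[k] k)}

theorem IsNormalized.pullback (h : IsNormalized σ) :
    IsNormalized (pullback (tensorSquare π) σ) := by
  intro a
  have e := (h (π a))
  simp only [pullback_apply, tensorSquare_tmul, map_one]
  rw [e.1, e.2]
  simp

theorem IsLeftCocycle.pullback (h : IsLeftCocycle σ) :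
    IsLeftCocycle (pullback (tensorSquare π) σ) := by
  let T : (A ⊗[k] A) ⊗[k] A →ₗc[k] (H ⊗[k] H) ⊗[k] H :=
    Coalgebra.TensorProduct.map (tensorSquare π) (π : A →ₗc[k] H)
  have hT (a b c : A) : T ((a ⊗ₜ b) ⊗ₜ c) = (π a ⊗ₜ[k] π b) ⊗ₜ[k] π c := rfl
  have e := congr(LazyCohomology.pullback T $h)
  rw [map_mul, map_mul] at e
  unfold IsLeftCocycle
  convert e using 2 <;> ext a b c <;>
    simp [LazyCohomology.pullback, hT, ← TensorProduct.smul_tmul']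

variable (π) in
/-- The element `a` is homogeneous of degree `u` for the coactions of `H` on `A` through `π`, both
on the left and on the right. -/
structure IsHomogeneous (a : A) (u : H) : Prop where
  left : TensorProduct.map (π : A →ₗ[k] H) LinearMap.id (comul (R := k) a) = u ⊗ₜ a
  right : TensorProduct.map LinearMap.id (π : A →ₗ[k] H) (comul (R := k) a) = a ⊗ₜ u

theorem IsHomogeneous.mul {a b : A} {u v : H} (ha : IsHomogeneous π a u)
    (hb : IsHomogeneous π b v) : IsHomogeneous π (a * b) (u * v) where
  left := by
    have e (t : A ⊗[k] A) : TensorProduct.map (π : A →ₗ[k] H) LinearMap.id t =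
      Algebra.TensorProduct.map (π : A →ₐ[k] H) (AlgHom.id k A) t := rfl
    have h1 := ha.left
    have h2 := hb.left
    rw [e] at h1 h2 ⊢
    rw [Bialgebra.comul_mul, map_mul, h1, h2, Algebra.TensorProduct.tmul_mul_tmul]
  right := by
    have e (t : A ⊗[k] A) : TensorProduct.map LinearMap.id (π : A →ₗ[k] H) t =
      Algebra.TensorProduct.map (AlgHom.id k A) (π : A →ₐ[k] H) t := rfl
    have h1 := ha.right
    have h2 := hb.right
    rw [e] at h1 h2 ⊢
    rw [Bialgebra.comul_mul, map_mul, h1, h2, Algebra.TensorProduct.tmul_mul_tmul]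

theorem IsHomogeneous.one : IsHomogeneous π 1 1 where
  left := by simp [Algebra.TensorProduct.one_def]
  right := by simp [Algebra.TensorProduct.one_def]

theorem IsHomogeneous.pow {a : A} {u : H} (ha : IsHomogeneous π a u) (n : ℕ) :
    IsHomogeneous π (a ^ n) (u ^ n) := by
  induction n with
  | zero => simpa using IsHomogeneous.one
  | succ n ih => rw [pow_succ, pow_succ]; exact ih.mul ha

variable {M : Type*} [AddCommGroup M] [Module k M] {a b : A} {u v : H}

theorem IsHomogeneous.sum_left (ha : IsHomogeneous π a u) (L : H →ₗ[k] A →ₗ[k] M) :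
    ∑ i ∈ (ℛ k a).index, L (π ((ℛ k a).left i)) ((ℛ k a).right i) = L u a := by
  have := congr(TensorProduct.lift L $(ha.left))
  rw [← (ℛ k a).eq] at this
  simpa using this

theorem IsHomogeneous.sum_right (ha : IsHomogeneous π a u) (L : H →ₗ[k] A →ₗ[k] M) :
    ∑ i ∈ (ℛ k a).index, L (π ((ℛ k a).right i)) ((ℛ k a).left i) = L u a := by
  have := congr(TensorProduct.lift L.flip $(ha.right))
  rw [← (ℛ k a).eq] at this
  simpa using this

/-- Linear forms pulled back from `H` are lazy at homogeneous elements. -/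
theorem IsHomogeneous.lazy₁ (ha : IsHomogeneous π a u) (f : WithConv (H →ₗ[k] k)) :
    (scalar A (LazyCohomology.pullback (π : A →ₗc[k] H) f) *
        toConv (LinearMap.id : A →ₗ[k] A)) a =
      (toConv (LinearMap.id : A →ₗ[k] A) *
        scalar A (LazyCohomology.pullback (π : A →ₗc[k] H) f)) a := by
  let L : H →ₗ[k] A →ₗ[k] A := LinearMap.lsmul k A ∘ₗ f.ofConv
  rw [(ℛ k a).convMul_apply, (ℛ k a).convMul_apply]
  have e := (ha.sum_left L).trans (ha.sum_right L).symm
  simpa [L, scalar_apply, pullback_apply, Algebra.smul_def, Algebra.commutes] using e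

/-- Bilinear forms pulled back from `H` are lazy at pairs of homogeneous elements. -/
theorem IsHomogeneous.lazy₂ (ha : IsHomogeneous π a u) (hb : IsHomogeneous π b v) :
    (scalar A (LazyCohomology.pullback (tensorSquare π) σ) * toConv (LinearMap.mul' k A))
      (a ⊗ₜ b) =
    (toConv (LinearMap.mul' k A) * scalar A (LazyCohomology.pullback (tensorSquare π) σ))
      (a ⊗ₜ b) := by
  let L (p : H) (q : A) : H →ₗ[k] A →ₗ[k] A := LinearMap.mk₂ k (fun h c => σ (p ⊗ₜ h) • (q * c))
    (by simp [TensorProduct.tmul_add, add_smul]) (by simp [mul_smul])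
    (by simp [mul_add]) (fun c m n => by rw [mul_smul_comm, smul_comm])
  let L' (p : H) (q : A) : H →ₗ[k] A →ₗ[k] A := LinearMap.mk₂ k (fun h c => σ (h ⊗ₜ p) • (c * q))
    (by simp [TensorProduct.add_tmul, add_smul])
    (by simp [← TensorProduct.smul_tmul', mul_smul])
    (by simp [add_mul]) (fun c m n => by rw [smul_mul_assoc, smul_comm])
  have e1 (p q) := hb.sum_left (L p q)
  have e2 (p q) := hb.sum_right (L p q)
  have e3 := (ha.sum_left (L' v b)).trans (ha.sum_right (L' v b)).symm
  simp only [L, L', LinearMap.mk₂_apply] at e1 e2 e3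
  rw [((ℛ k a).tmul (ℛ k b)).convMul_apply, ((ℛ k a).tmul (ℛ k b)).convMul_apply]
  simp only [Coalgebra.Repr.tmul_index, Coalgebra.Repr.tmul_left, Coalgebra.Repr.tmul_right,
    Finset.sum_product, scalar_apply, pullback_apply, tensorSquare_tmul, ← Algebra.commutes,
    ← Algebra.smul_def, LinearMap.mul'_apply, e1, e2, e3]

end Pullback

/-! ### Linear forms on a group algebra -/

section GroupAlgebra

variable {k : Type*} [Field k] {Q : Type*}

variable (k) in
theorem isGroupLike_single (q : Q) : IsGroupLikeElem k (MonoidAlgebra.single q (1 : k)) :=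
  MonoidAlgebra.isGroupLikeElem_single_one q

variable (k) in
theorem isGroupLike_single₂ (q r : Q) : IsGroupLikeElem k
    (MonoidAlgebra.single q (1 : k) ⊗ₜ[k] MonoidAlgebra.single r (1 : k)) :=
  IsGroupLikeElem.tmul (isGroupLike_single k q) (isGroupLike_single k r)

theorem groupAlgebra_ext {f f' : WithConv (MonoidAlgebra k Q →ₗ[k] k)}
    (h : ∀ q, f (MonoidAlgebra.single q 1) = f' (MonoidAlgebra.single q 1)) : f = f' :=
  WithConv.ofConv_injective (MonoidAlgebra.lhom_ext' fun q => LinearMap.ext_ring (h q))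

theorem groupAlgebra_ext₂ {f f' : WithConv (MonoidAlgebra k Q ⊗[k] MonoidAlgebra k Q →ₗ[k] k)}
    (h : ∀ q r, f (MonoidAlgebra.single q 1 ⊗ₜ MonoidAlgebra.single r 1) =
      f' (MonoidAlgebra.single q 1 ⊗ₜ MonoidAlgebra.single r 1)) : f = f' :=
  WithConv.ofConv_injective (TensorProduct.ext (MonoidAlgebra.lhom_ext' fun q =>
    LinearMap.ext_ring (MonoidAlgebra.lhom_ext' fun r => LinearMap.ext_ring (h q r))))

/-- The linear form on the group algebra with prescribed values on the group. -/
def linForm₁ (f : Q → k) : WithConv (MonoidAlgebra k Q →ₗ[k] k) :=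
  toConv ((MonoidAlgebra.basis Q k).constr k f)

@[simp] theorem linForm₁_single (f : Q → k) (q : Q) :
    linForm₁ f (MonoidAlgebra.single q 1) = f q :=
  (MonoidAlgebra.basis Q k).constr_basis k f q

/-- The bilinear form on the group algebra with prescribed values on the group. -/
def linForm₂ (f : Q → Q → k) : WithConv (MonoidAlgebra k Q ⊗[k] MonoidAlgebra k Q →ₗ[k] k) :=
  toConv (TensorProduct.lift ((MonoidAlgebra.basis Q k).constr k fun q =>
    (linForm₁ (f q)).ofConv))

@[simp] theorem linForm₂_single (f : Q → Q → k) (q r : Q) :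
    linForm₂ f (MonoidAlgebra.single q 1 ⊗ₜ MonoidAlgebra.single r 1) = f q r :=
  congr($((MonoidAlgebra.basis Q k).constr_basis k (fun q => (linForm₁ (f q)).ofConv) q)
    (MonoidAlgebra.single r 1)).trans (linForm₁_single (f q) r)

variable [Group Q]

variable (k Q) in
/-- Functions `Q → kˣ` as convolution invertible linear forms on the group algebra. -/
def groupForm₁ : (Q → kˣ) →* ConvUnits₁ k (MonoidAlgebra k Q) :=
  MonoidHom.toHomUnits
    { toFun := fun f => linForm₁ fun q => (f q : k)
      map_one' := groupAlgebra_ext fun q => by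
        rw [← evalGroupLike_apply (isGroupLike_single k q),
          ← evalGroupLike_apply (isGroupLike_single k q), map_one]
        exact linForm₁_single _ q
      map_mul' := fun f f' => groupAlgebra_ext fun q => by
        rw [← evalGroupLike_apply (isGroupLike_single k q),
          ← evalGroupLike_apply (isGroupLike_single k q), map_mul]
        simp only [evalGroupLike_apply, linForm₁_single, Pi.mul_apply, Units.val_mul] }

variable (k Q) in
/-- Functions `Q × Q → kˣ` as convolution invertible forms on the tensor square of the group
algebra. -/
def groupForm₂ : (Q → Q → kˣ) →* ConvUnits₂ k (MonoidAlgebra k Q) :=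
  MonoidHom.toHomUnits
    { toFun := fun f => linForm₂ fun q r => (f q r : k)
      map_one' := groupAlgebra_ext₂ fun q r => by
        rw [← evalGroupLike_apply (isGroupLike_single₂ k q r),
          ← evalGroupLike_apply (isGroupLike_single₂ k q r), map_one]
        exact linForm₂_single _ q r
      map_mul' := fun f f' => groupAlgebra_ext₂ fun q r => by
        rw [← evalGroupLike_apply (isGroupLike_single₂ k q r),
          ← evalGroupLike_apply (isGroupLike_single₂ k q r), map_mul]
        simp only [evalGroupLike_apply, linForm₂_single, Pi.mul_apply, Units.val_mul] }

@[simp] theorem groupForm₁_single (f : Q → kˣ) (q : Q) :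
    (groupForm₁ k Q f).val (MonoidAlgebra.single q 1) = f q := linForm₁_single _ q

@[simp] theorem groupForm₂_single (f : Q → Q → kˣ) (q r : Q) :
    (groupForm₂ k Q f).val (MonoidAlgebra.single q 1 ⊗ₜ MonoidAlgebra.single r 1) = f q r :=
  linForm₂_single _ q r

theorem groupZ₂_one_left {α : Q → Q → kˣ} (hα : α ∈ groupZ₂ Q kˣ) (q : Q) : α 1 q = α 1 1 := by
  have := hα 1 1 q
  simpa using this.symm

theorem groupZ₂_one_right {α : Q → Q → kˣ} (hα : α ∈ groupZ₂ Q kˣ) (q : Q) : α q 1 = α 1 1 := by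
  have := hα q 1 1
  simpa using this

theorem isNormalized_groupForm₂ {α : Q → Q → kˣ} (hα : α ∈ groupZ₂ Q kˣ) (h1 : α 1 1 = 1) :
    IsNormalized (groupForm₂ k Q α).val := by
  rw [isNormalized_iff]
  constructor
  · refine groupAlgebra_ext fun q => ?_
    rw [pullback_apply, inl_apply, MonoidAlgebra.one_def, groupForm₂_single,
      groupZ₂_one_right hα, h1]
    simp
  · refine groupAlgebra_ext fun q => ?_
    rw [pullback_apply, inr_apply, MonoidAlgebra.one_def, groupForm₂_single,
      groupZ₂_one_left hα, h1]
    simp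

theorem isLeftCocycle_groupForm₂ {α : Q → Q → kˣ} (hα : α ∈ groupZ₂ Q kˣ) :
    IsLeftCocycle (groupForm₂ k Q α).val := by
  refine WithConv.ofConv_injective (TensorProduct.ext (TensorProduct.ext
    (MonoidAlgebra.lhom_ext' fun q => LinearMap.ext_ring (MonoidAlgebra.lhom_ext' fun r =>
      LinearMap.ext_ring (MonoidAlgebra.lhom_ext' fun t => LinearMap.ext_ring ?_)))))
  have hg := IsGroupLikeElem.tmul (isGroupLike_single₂ k q r) (isGroupLike_single k t)
  change evalGroupLike hg (pullback (pr₁₂ k _) (groupForm₂ k Q α).val * pullback (mul₁₂ k _) _) =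
    evalGroupLike hg (pullback (pr₂₃ k _) (groupForm₂ k Q α).val * pullback (mul₂₃ k _) _)
  rw [map_mul, map_mul]
  simp only [evalGroupLike_apply, pullback_apply, pr₁₂_tmul, mul₁₂_tmul, pr₂₃_tmul, mul₂₃_tmul,
    MonoidAlgebra.counit_single, MonoidAlgebra.single_mul_single, mul_one,
    CommSemiring.counit_apply, one_smul, groupForm₂_single]
  exact_mod_cast hα q r t

end GroupAlgebra

end LazyCohomology

namespace GroupDatum

open LazyCohomology

variable {k : Type*} [Field k] {G : Type*} [Group G] [Finite G] (𝔾 : GroupDatum k G)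

/-! ### Inflation from `G / ⟨g⟩` -/

/-- The quotient group `G / ⟨g⟩`. -/
abbrev QuotientGrp : Type _ := G ⧸ Subgroup.zpowers 𝔾.g

theorem mk_mul_g_pow (h : G) (n : ℕ) : ((h * 𝔾.g ^ n : G) : 𝔾.QuotientGrp) = h :=
  QuotientGroup.mk_mul_of_mem h (Subgroup.npow_mem_zpowers 𝔾.g n)

theorem mk_g : ((𝔾.g : G) : 𝔾.QuotientGrp) = 1 := by simp

/-- The bialgebra map from `A(𝔾)` to the group algebra of `G / ⟨g⟩`, with `x ↦ 0`. -/
def toQuot : 𝔾.A →ₐc[k] MonoidAlgebra k 𝔾.QuotientGrp :=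
  BialgHom.ofAlgHom
    (lift 0 ((MonoidAlgebra.of k 𝔾.QuotientGrp).comp (QuotientGroup.mk' (Subgroup.zpowers 𝔾.g)))
      (fun h => by simp)
      (by
        have := 𝔾.mk_mul_g_pow 1 𝔾.d
        rw [one_mul] at this
        rw [zero_pow 𝔾.d_pos.ne', MonoidHom.comp_apply, QuotientGroup.mk'_apply, this,
          QuotientGroup.mk_one, map_one, sub_self, smul_zero]))
    (algHom_ext (by simp) (fun h => by simp))
    (algHom_ext (by simp) (fun h => by simp))

@[simp] theorem toQuot_x : 𝔾.toQuot 𝔾.x = 0 := lift_x _ _ _ _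

@[simp] theorem toQuot_of (h : G) :
    𝔾.toQuot (𝔾.of h) = MonoidAlgebra.single (h : 𝔾.QuotientGrp) 1 := lift_of _ _ _ _ h

/-- The monomials are homogeneous because `g` becomes trivial in the quotient: `A(𝔾)` is cocentral
over the group algebra of `G / ⟨g⟩`. -/
theorem isHomogeneous_monomial (l : G) (n : ℕ) :
    IsHomogeneous 𝔾.toQuot (𝔾.of l * 𝔾.x ^ n) (MonoidAlgebra.single (l : 𝔾.QuotientGrp) 1) := by
  have hx : IsHomogeneous 𝔾.toQuot 𝔾.x 1 := by
    constructor
    · simp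
    · simp [mk_g, MonoidAlgebra.one_def]
  have hl : IsHomogeneous 𝔾.toQuot (𝔾.of l) (MonoidAlgebra.single (l : 𝔾.QuotientGrp) 1) := by
    constructor <;> simp
  simpa using hl.mul (hx.pow n)

/-- Functions on `G / ⟨g⟩` as convolution invertible forms on `A(𝔾)`. -/
def infl₁ : (𝔾.QuotientGrp → kˣ) →* ConvUnits₁ k 𝔾.A :=
  (Units.map (pullback (𝔾.toQuot : 𝔾.A →ₗc[k] MonoidAlgebra k 𝔾.QuotientGrp))).comp
    (groupForm₁ k 𝔾.QuotientGrp)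

/-- Functions of two variables on `G / ⟨g⟩` as convolution invertible forms on `A(𝔾) ⊗ A(𝔾)`. -/
def infl₂ : (𝔾.QuotientGrp → 𝔾.QuotientGrp → kˣ) →* ConvUnits₂ k 𝔾.A :=
  (Units.map (pullback (tensorSquare 𝔾.toQuot))).comp (groupForm₂ k 𝔾.QuotientGrp)

theorem infl₁_apply (ν : 𝔾.QuotientGrp → kˣ) (a : 𝔾.A) :
    (𝔾.infl₁ ν).val a = (groupForm₁ k 𝔾.QuotientGrp ν).val (𝔾.toQuot a) := rfl

theorem infl₂_apply (α : 𝔾.QuotientGrp → 𝔾.QuotientGrp → kˣ) (a b : 𝔾.A) :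
    (𝔾.infl₂ α).val (a ⊗ₜ b) =
      (groupForm₂ k 𝔾.QuotientGrp α).val (𝔾.toQuot a ⊗ₜ 𝔾.toQuot b) := rfl

theorem infl₁_mem {ν : 𝔾.QuotientGrp → kˣ} (hν : ν 1 = 1) : 𝔾.infl₁ ν ∈ Reg₁L k 𝔾.A := by
  refine ⟨?_, WithConv.ofConv_injective (𝔾.linearMap_ext fun l n hn => ?_)⟩
  · rw [infl₁_apply, map_one, MonoidAlgebra.one_def, groupForm₁_single, hν, Units.val_one]
  · exact (𝔾.isHomogeneous_monomial l n).lazy₁ (groupForm₁ k 𝔾.QuotientGrp ν).val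

theorem infl₂_mem {α : 𝔾.QuotientGrp → 𝔾.QuotientGrp → kˣ} (hα : α ∈ groupZ₂ _ kˣ)
    (h1 : α 1 1 = 1) : 𝔾.infl₂ α ∈ Z₂L k 𝔾.A := by
  refine ⟨(isNormalized_groupForm₂ hα h1).pullback,
    WithConv.ofConv_injective (TensorProduct.ext (𝔾.linearMap_ext fun l n hn =>
      𝔾.linearMap_ext fun m j hj => ?_)), (isLeftCocycle_groupForm₂ hα).pullback⟩
  exact (𝔾.isHomogeneous_monomial l n).lazy₂ (𝔾.isHomogeneous_monomial m j)

end GroupDatum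

namespace GroupDatum

open LazyCohomology

variable {k : Type*} [Field k] {G : Type*} [Group G] [Finite G] {𝔾 : GroupDatum k G}

/-! ### The lazy cocycles with given parameter in type I -/

theorem IsTypeI.g_pow (h : 𝔾.IsTypeI) : 𝔾.g ^ 𝔾.d = 1 := by
  rw [h.2.1, pow_orderOf_eq_one]

theorem IsTypeI.x_pow (h : 𝔾.IsTypeI) : 𝔾.x ^ 𝔾.d = 0 := by
  rw [GroupDatum.x_pow, h.1, zero_smul]

namespace Deformed

theorem monomial_expand {B : Type*} [Ring B] [Algebra k B] {q : k} {u v : B}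
    (h : v * u = q • (u * v)) (w : B) (n : ℕ) : w * (u + v) ^ n =
      ∑ j ∈ Finset.range (n + 1), gauss q n j • (w * (u ^ j * v ^ (n - j))) := by
  rw [add_pow_gauss h, Finset.mul_sum]
  simp only [mul_smul_comm]

variable (s : k)

section Coaction

theorem qcomm_right : (1 ⊗ₜ 𝔾.x) * (x 𝔾 s ⊗ₜ 𝔾.of 𝔾.g) =
    (𝔾.χ 𝔾.g : k) • ((x 𝔾 s ⊗ₜ 𝔾.of 𝔾.g) * ((1 : 𝔾.Deformed s) ⊗ₜ[k] 𝔾.x)) := by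
  simp only [Algebra.TensorProduct.tmul_mul_tmul, one_mul, mul_one, GroupDatum.x_mul_of,
    TensorProduct.tmul_smul]

theorem qcomm_left : (1 ⊗ₜ x 𝔾 s) * (𝔾.x ⊗ₜ of 𝔾 s 𝔾.g) =
    (𝔾.χ 𝔾.g : k) • ((𝔾.x ⊗ₜ of 𝔾 s 𝔾.g) * ((1 : 𝔾.A) ⊗ₜ[k] x 𝔾 s)) := by
  simp only [Algebra.TensorProduct.tmul_mul_tmul, one_mul, mul_one, x_mul_of,
    TensorProduct.tmul_smul]

/-- The right coaction of `A(𝔾)`, with `x ↦ x ⊗ g + 1 ⊗ x` and `h ↦ h ⊗ h`. -/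
def coactRight (h𝔾 : 𝔾.IsTypeI) : 𝔾.Deformed s →ₐ[k] 𝔾.Deformed s ⊗[k] 𝔾.A :=
  lift (x 𝔾 s ⊗ₜ 𝔾.of 𝔾.g + 1 ⊗ₜ 𝔾.x)
    { toFun := fun h => of 𝔾 s h ⊗ₜ 𝔾.of h
      map_one' := by rw [map_one, map_one, Algebra.TensorProduct.one_def]
      map_mul' := fun h l => by rw [map_mul, map_mul, Algebra.TensorProduct.tmul_mul_tmul] }
    (fun h => by
      simp only [MonoidHom.coe_mk, OneHom.coe_mk, add_mul, mul_add,
        Algebra.TensorProduct.tmul_mul_tmul, one_mul, mul_one, x_mul_of, GroupDatum.x_mul_of,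
        ← map_mul, comm_g, smul_add, TensorProduct.tmul_smul, ← TensorProduct.smul_tmul'])
    (by
      rw [add_pow_of_primitive 𝔾.d_pos 𝔾.isPrimitiveRoot (qcomm_right s)]
      simp only [Algebra.TensorProduct.tmul_pow, one_pow, x_pow, h𝔾.x_pow, ← map_pow, h𝔾.1,
        h𝔾.g_pow, zero_smul, zero_add, map_one, TensorProduct.tmul_zero, add_zero]
      rfl)

/-- The left coaction of `A(𝔾)`, with `x ↦ x ⊗ g + 1 ⊗ x` and `h ↦ h ⊗ h`. -/
def coactLeft (h𝔾 : 𝔾.IsTypeI) : 𝔾.Deformed s →ₐ[k] 𝔾.A ⊗[k] 𝔾.Deformed s :=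
  lift (𝔾.x ⊗ₜ of 𝔾 s 𝔾.g + 1 ⊗ₜ x 𝔾 s)
    { toFun := fun h => 𝔾.of h ⊗ₜ of 𝔾 s h
      map_one' := by rw [map_one, map_one, Algebra.TensorProduct.one_def]
      map_mul' := fun h l => by rw [map_mul, map_mul, Algebra.TensorProduct.tmul_mul_tmul] }
    (fun h => by
      simp only [MonoidHom.coe_mk, OneHom.coe_mk, add_mul, mul_add,
        Algebra.TensorProduct.tmul_mul_tmul, one_mul, mul_one, x_mul_of, GroupDatum.x_mul_of,
        ← map_mul, comm_g, smul_add, TensorProduct.tmul_smul, ← TensorProduct.smul_tmul'])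
    (by
      rw [add_pow_of_primitive 𝔾.d_pos 𝔾.isPrimitiveRoot (qcomm_left s)]
      simp only [Algebra.TensorProduct.tmul_pow, one_pow, x_pow, h𝔾.x_pow, ← map_pow, h𝔾.1,
        h𝔾.g_pow, zero_smul, zero_add, map_one, TensorProduct.zero_tmul,
        Algebra.algebraMap_eq_smul_one, TensorProduct.tmul_smul, Algebra.TensorProduct.one_def])

theorem coactRight_monomial (h𝔾 : 𝔾.IsTypeI) (l : G) (n : ℕ) :
    coactRight s h𝔾 (of 𝔾 s l * x 𝔾 s ^ n) =
      ∑ j ∈ Finset.range (n + 1), gauss (𝔾.χ 𝔾.g : k) n j •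
        ((of 𝔾 s l * x 𝔾 s ^ j) ⊗ₜ[k] (𝔾.of (l * 𝔾.g ^ j) * 𝔾.x ^ (n - j))) := by
  rw [map_mul, map_pow, coactRight, lift_x, lift_of, monomial_expand (qcomm_right s)]
  simp [Algebra.TensorProduct.tmul_pow, mul_assoc]

theorem coactLeft_monomial (h𝔾 : 𝔾.IsTypeI) (l : G) (n : ℕ) :
    coactLeft s h𝔾 (of 𝔾 s l * x 𝔾 s ^ n) =
      ∑ j ∈ Finset.range (n + 1), gauss (𝔾.χ 𝔾.g : k) n j •
        ((𝔾.of l * 𝔾.x ^ j) ⊗ₜ[k] (of 𝔾 s (l * 𝔾.g ^ j) * x 𝔾 s ^ (n - j))) := by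
  rw [map_mul, map_pow, coactLeft, lift_x, lift_of, monomial_expand (qcomm_left s)]
  simp [Algebra.TensorProduct.tmul_pow, mul_assoc]

end Coaction

theorem exists_section : ∃ θ : 𝔾.A →ₗ[k] 𝔾.Deformed s,
    ∀ l n, n < 𝔾.d → θ (𝔾.of l * 𝔾.x ^ n) = of 𝔾 s l * x 𝔾 s ^ n := by
  classical
  have := Fintype.ofFinite G
  refine ⟨∑ l : G, ∑ n ∈ Finset.range 𝔾.d,
    (𝔾.coord l n).smulRight (of 𝔾 s l * x 𝔾 s ^ n), fun l n hn => ?_⟩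
  simp only [LinearMap.sum_apply, LinearMap.smulRight_apply, 𝔾.coord_monomial _ _ _ hn]
  rw [Finset.sum_eq_single_of_mem l (Finset.mem_univ l),
    Finset.sum_eq_single_of_mem n (Finset.mem_range.2 hn)]
  · simp
  · intro j _ hj
    rw [if_neg fun h => hj h.2.symm, zero_smul]
  · intro m _ hm
    refine Finset.sum_eq_zero fun j _ => ?_
    rw [if_neg fun h => hm h.1.symm, zero_smul]

/-- The linear isomorphism `A(𝔾) → 𝔾.Deformed s` that preserves the monomials `l xⁿ`, `n < d`. -/
def sect : 𝔾.A →ₗ[k] 𝔾.Deformed s := (exists_section s).choose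

variable {s}

theorem sect_monomial (l : G) {n : ℕ} (hn : n < 𝔾.d) :
    sect s (𝔾.of l * 𝔾.x ^ n) = of 𝔾 s l * x 𝔾 s ^ n := (exists_section s).choose_spec l n hn

theorem sect_of (l : G) : sect s (𝔾.of l) = of 𝔾 s l := by
  simpa using sect_monomial (s := s) l 𝔾.d_pos

theorem coactRight_sect (h𝔾 : 𝔾.IsTypeI) (a : 𝔾.A) : coactRight s h𝔾 (sect s a) =
    TensorProduct.map (sect s) LinearMap.id (comul (R := k) a) := by
  refine congr($(𝔾.linearMap_ext (f := (coactRight s h𝔾).toLinearMap ∘ₗ sect s)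
    (f' := TensorProduct.map (sect s) LinearMap.id ∘ₗ comul) fun l n hn => ?_) a)
  simp only [LinearMap.comp_apply, AlgHom.toLinearMap_apply, sect_monomial l hn,
    coactRight_monomial, comul_of_mul_x_pow, map_sum, map_smul, TensorProduct.map_tmul,
    LinearMap.id_apply]
  refine Finset.sum_congr rfl fun j hj => ?_
  rw [Finset.mem_range] at hj
  rw [sect_monomial l (by omega)]

theorem coactLeft_sect (h𝔾 : 𝔾.IsTypeI) (a : 𝔾.A) : coactLeft s h𝔾 (sect s a) =
    TensorProduct.map LinearMap.id (sect s) (comul (R := k) a) := by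
  refine congr($(𝔾.linearMap_ext (f := (coactLeft s h𝔾).toLinearMap ∘ₗ sect s)
    (f' := TensorProduct.map LinearMap.id (sect s) ∘ₗ comul) fun l n hn => ?_) a)
  simp only [LinearMap.comp_apply, AlgHom.toLinearMap_apply, sect_monomial l hn,
    coactLeft_monomial, comul_of_mul_x_pow, map_sum, map_smul, TensorProduct.map_tmul,
    LinearMap.id_apply]
  refine Finset.sum_congr rfl fun j hj => ?_
  rw [Finset.mem_range] at hj
  rw [sect_monomial _ (by omega : n - j < 𝔾.d)]

variable (s) in
/-- The linear form on `𝔾.Deformed s` that corresponds to the counit of `A(𝔾)`. -/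
def augment (h𝔾 : 𝔾.IsTypeI) : 𝔾.Deformed s →ₗ[k] k :=
  (exists_form 𝔾 (s := s) (fun _ => h𝔾.2.2) fun _ n => if n = 0 then 1 else 0).choose

theorem augment_monomial (h𝔾 : 𝔾.IsTypeI) (l : G) {n : ℕ} (hn : n < 𝔾.d) :
    augment s h𝔾 (of 𝔾 s l * x 𝔾 s ^ n) = if n = 0 then 1 else 0 :=
  (exists_form 𝔾 (s := s) (fun _ => h𝔾.2.2) fun _ n => if n = 0 then 1 else 0).choose_spec l n hn

theorem augment_sect (h𝔾 : 𝔾.IsTypeI) (a : 𝔾.A) :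
    augment s h𝔾 (sect s a) = counit (R := k) a := by
  refine congr($(𝔾.linearMap_ext (f := augment s h𝔾 ∘ₗ sect s) (f' := counit)
    fun l n hn => ?_) a)
  rw [LinearMap.comp_apply, sect_monomial l hn, augment_monomial h𝔾 l hn, counit_monomial]

/-- The inverse of `sect`, expressed through the right coaction. -/
def retract (h𝔾 : 𝔾.IsTypeI) : 𝔾.Deformed s →ₗ[k] 𝔾.A :=
  (TensorProduct.lid k 𝔾.A).toLinearMap ∘ₗ TensorProduct.map (augment s h𝔾) LinearMap.id ∘ₗ
    (coactRight s h𝔾).toLinearMap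

theorem retract_monomial (h𝔾 : 𝔾.IsTypeI) (l : G) {n : ℕ} (hn : n < 𝔾.d) :
    retract h𝔾 (of 𝔾 s l * x 𝔾 s ^ n) = 𝔾.of l * 𝔾.x ^ n := by
  simp only [retract, LinearMap.comp_apply, AlgHom.toLinearMap_apply, coactRight_monomial, map_sum,
    map_smul, TensorProduct.map_tmul, LinearEquiv.coe_coe, TensorProduct.lid_tmul]
  rw [Finset.sum_eq_single_of_mem 0 (by simp)]
  · rw [augment_monomial h𝔾 l 𝔾.d_pos, gauss_zero]
    simp
  · intro j hj hj0
    rw [Finset.mem_range] at hj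
    rw [augment_monomial h𝔾 l (by omega), if_neg hj0, zero_smul, smul_zero]

/-- The inverse of `sect` can also be expressed through the left coaction. -/
theorem retract_eq (h𝔾 : 𝔾.IsTypeI) (b : 𝔾.Deformed s) : retract h𝔾 b =
    TensorProduct.rid k 𝔾.A (TensorProduct.map LinearMap.id (augment s h𝔾)
      (coactLeft s h𝔾 b)) := by
  refine congr($(linearMap_ext 𝔾 (f := retract h𝔾)
    (f' := (TensorProduct.rid k 𝔾.A).toLinearMap ∘ₗ
      TensorProduct.map LinearMap.id (augment s h𝔾) ∘ₗ (coactLeft s h𝔾).toLinearMap)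
    fun l n hn => ?_) b)
  rw [retract_monomial h𝔾 l hn]
  simp only [LinearMap.comp_apply, AlgHom.toLinearMap_apply, coactLeft_monomial, map_sum,
    map_smul, TensorProduct.map_tmul, LinearEquiv.coe_coe, TensorProduct.rid_tmul]
  rw [Finset.sum_eq_single_of_mem n (by simp)]
  · have := augment_monomial (s := s) h𝔾 (l * 𝔾.g ^ n) 𝔾.d_pos
    rw [Nat.sub_self, this, gauss_self]
    simp
  · intro j hj hj0
    rw [Finset.mem_range] at hj
    rw [augment_monomial h𝔾 _ (by omega), if_neg (by omega), zero_smul, smul_zero]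

theorem sect_retract (h𝔾 : 𝔾.IsTypeI) (b : 𝔾.Deformed s) : sect s (retract h𝔾 b) = b := by
  refine congr($(linearMap_ext 𝔾 (f := sect s ∘ₗ retract h𝔾) (f' := LinearMap.id)
    fun l n hn => ?_) b)
  rw [LinearMap.comp_apply, retract_monomial h𝔾 l hn, sect_monomial l hn, LinearMap.id_apply]

variable (s) in
/-- The lazy cocycle with parameter `s`: the counit of a product in `𝔾.Deformed s`. -/
def cocycle (h𝔾 : 𝔾.IsTypeI) : WithConv (𝔾.A ⊗[k] 𝔾.A →ₗ[k] k) :=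
  toConv (augment s h𝔾 ∘ₗ LinearMap.mul' k _ ∘ₗ TensorProduct.map (sect s) (sect s))

theorem cocycle_apply (h𝔾 : 𝔾.IsTypeI) (a b : 𝔾.A) :
    cocycle s h𝔾 (a ⊗ₜ b) = augment s h𝔾 (sect s a * sect s b) := rfl

/-- The product of `A(𝔾)` twisted by the cocycle is the product of `𝔾.Deformed s`, transported along
`sect`; this is where the right coaction is used. -/
theorem twist_cocycle (h𝔾 : 𝔾.IsTypeI) (a b : 𝔾.A) :
    twist (cocycle s h𝔾) a b = retract h𝔾 (sect s a * sect s b) := by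
  rw [twist_apply (ℛ k a) (ℛ k b), retract, LinearMap.comp_apply, LinearMap.comp_apply,
    AlgHom.toLinearMap_apply, map_mul, coactRight_sect, coactRight_sect, ← (ℛ k a).eq,
    ← (ℛ k b).eq]
  simp [Finset.sum_mul_sum, cocycle_apply]

/-- Twisting on the other side by the cocycle gives the same product, by the left coaction. -/
theorem twist_cocycle' (h𝔾 : 𝔾.IsTypeI) (a b : 𝔾.A) :
    (toConv (LinearMap.mul' k 𝔾.A) * scalar 𝔾.A (cocycle s h𝔾)) (a ⊗ₜ b) =
      retract h𝔾 (sect s a * sect s b) := by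
  rw [((ℛ k a).tmul (ℛ k b)).convMul_apply, retract_eq, map_mul, coactLeft_sect, coactLeft_sect,
    ← (ℛ k a).eq, ← (ℛ k b).eq]
  simp [Finset.sum_mul_sum, cocycle_apply, scalar_apply, Finset.sum_product, ← Algebra.commutes,
    ← Algebra.smul_def]

theorem isLazyCocycle_cocycle (h𝔾 : 𝔾.IsTypeI) : IsLazyCocycle (cocycle s h𝔾) where
  normalized a := by
    have e : sect s (1 : 𝔾.A) = 1 := by simpa using sect_of (𝔾 := 𝔾) (s := s) 1
    rw [cocycle_apply, cocycle_apply, e, one_mul, mul_one, augment_sect]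
    exact ⟨rfl, rfl⟩
  lazy := WithConv.ofConv_injective (TensorProduct.ext' fun a b =>
    (twist_cocycle h𝔾 a b).trans (twist_cocycle' h𝔾 a b).symm)
  cocycle := isLeftCocycle_iff.2 fun a b c => by
    rw [cocycle_apply, cocycle_apply, twist_cocycle, twist_cocycle, sect_retract, sect_retract,
      mul_assoc]

theorem cocycle_of (h𝔾 : 𝔾.IsTypeI) (h l : G) :
    cocycle s h𝔾 (𝔾.of h ⊗ₜ 𝔾.of l) = 1 := by
  rw [cocycle_apply, sect_of, sect_of, ← map_mul]
  simpa using augment_monomial (s := s) h𝔾 (h * l) 𝔾.d_pos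

theorem param_cocycle (h𝔾 : 𝔾.IsTypeI) : 𝔾.param (cocycle s h𝔾) = s := by
  have h1 := sect_monomial (𝔾 := 𝔾) (s := s) 1 𝔾.one_lt_d
  have h2 := sect_monomial (𝔾 := 𝔾) (s := s) 1 (n := 𝔾.d - 1) (by have := 𝔾.d_pos; omega)
  have h3 := augment_monomial (s := s) h𝔾 1 𝔾.d_pos
  simp only [map_one, one_mul, pow_one, pow_zero, if_true] at h1 h2 h3
  rw [param, cocycle_apply, h1, h2, ← pow_succ', Nat.sub_add_cancel 𝔾.d_pos, x_pow, h𝔾.1,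
    zero_smul, zero_add, Algebra.algebraMap_eq_smul_one, map_smul, h3, smul_eq_mul, mul_one]

/-- The cocycles with parameters `s` and `-s` are inverse to each other, since lazy cocycles are
determined by the restriction to `G` and the parameter. -/
theorem cocycle_mul (h𝔾 : 𝔾.IsTypeI) (s t : k) (hst : s + t = 0) :
    cocycle s h𝔾 * cocycle t h𝔾 = 1 := by
  have hs := isLazyCocycle_cocycle (s := s) h𝔾
  have ht := isLazyCocycle_cocycle (s := t) h𝔾
  refine eq_of_apply_of (hs.mul ht) IsLazyCocycle.one (fun h l => ?_) ?_
  · have hg (h : G) : IsGroupLikeElem k (𝔾.of h) := ⟨by simp, by simp⟩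
    have hg' := IsGroupLikeElem.tmul (hg h) (hg l)
    rw [← evalGroupLike_apply hg', ← evalGroupLike_apply hg', map_mul, map_one,
      evalGroupLike_apply, evalGroupLike_apply, cocycle_of, cocycle_of, one_mul]
  · rw [param_mul hs ht, param_cocycle, param_cocycle, hst]
    simp [param]

/-- The lazy cocycle with parameter `s`, as a convolution invertible form. -/
def unitCocycle (h𝔾 : 𝔾.IsTypeI) (s : k) : ConvUnits₂ k 𝔾.A where
  val := cocycle s h𝔾
  inv := cocycle (-s) h𝔾
  val_inv := cocycle_mul h𝔾 _ _ (add_neg_cancel s)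
  inv_val := cocycle_mul h𝔾 _ _ (neg_add_cancel s)

theorem unitCocycle_mem (h𝔾 : 𝔾.IsTypeI) (s : k) : unitCocycle h𝔾 s ∈ Z₂L k 𝔾.A :=
  have h := isLazyCocycle_cocycle (s := s) h𝔾
  ⟨h.1, h.2, h.3⟩

end Deformed
end GroupDatum

namespace GroupDatum

open LazyCohomology

variable {k : Type*} [Field k] {G : Type*} [Group G] [Finite G] {𝔾 : GroupDatum k G}

/-! ### Restriction of lazy cocycles to `G / ⟨g⟩` -/

theorem isLazyCocycle_of_mem {σ : ConvUnits₂ k 𝔾.A} (hσ : σ ∈ Z₂L k 𝔾.A) :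
    IsLazyCocycle σ.val := ⟨hσ.1, hσ.2.1, hσ.2.2⟩

theorem isGroupLike_of (h : G) : IsGroupLikeElem k (𝔾.of h) := ⟨by simp, by simp⟩

variable (𝔾) in
/-- The value of an invertible form on `A(𝔾)` at `h ∈ G`. -/
def value₁ (h : G) : ConvUnits₁ k 𝔾.A →* kˣ := Units.map (evalGroupLike (isGroupLike_of h))

variable (𝔾) in
/-- The value of an invertible form on `A(𝔾) ⊗ A(𝔾)` at `h, l ∈ G`. -/
def value₂ (h l : G) : ConvUnits₂ k 𝔾.A →* kˣ :=
  Units.map (evalGroupLike (IsGroupLikeElem.tmul (isGroupLike_of h) (isGroupLike_of l)))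

theorem val_value₁ (h : G) (μ : ConvUnits₁ k 𝔾.A) : (𝔾.value₁ h μ : k) = μ.val (𝔾.of h) := rfl

theorem val_value₂ (h l : G) (σ : ConvUnits₂ k 𝔾.A) :
    (𝔾.value₂ h l σ : k) = σ.val (𝔾.of h ⊗ₜ 𝔾.of l) := rfl

theorem exists_out_eq (h : G) : ∃ n : ℕ, (h : 𝔾.QuotientGrp).out = h * 𝔾.g ^ n := by
  obtain ⟨⟨z, hz⟩, e⟩ := QuotientGroup.mk_out_eq_mul (Subgroup.zpowers 𝔾.g) h
  obtain ⟨n, rfl⟩ := mem_powers_iff_mem_zpowers.2 hz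
  exact ⟨n, e⟩

variable (𝔾) in
/-- The restriction of forms on `A(𝔾) ⊗ A(𝔾)` to `G`, as functions on `G / ⟨g⟩`. The values at
chosen representatives are taken; for lazy cocycles the choice does not matter. -/
def restrict : ConvUnits₂ k 𝔾.A →* (𝔾.QuotientGrp → 𝔾.QuotientGrp → kˣ) :=
  MonoidHom.pi fun q => MonoidHom.pi fun r => 𝔾.value₂ q.out r.out

theorem restrict_mk {σ : ConvUnits₂ k 𝔾.A} (hσ : σ ∈ Z₂L k 𝔾.A) (h l : G) :
    𝔾.restrict σ h l = 𝔾.value₂ h l σ := by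
  have hσ := isLazyCocycle_of_mem hσ
  change 𝔾.value₂ (h : 𝔾.QuotientGrp).out (l : 𝔾.QuotientGrp).out σ = _
  obtain ⟨n, hn⟩ := 𝔾.exists_out_eq h
  obtain ⟨m, hm⟩ := 𝔾.exists_out_eq l
  ext
  rw [hn, hm, val_value₂, val_value₂, apply_of_g_pow hσ, apply_g_pow_of hσ]

theorem restrict_mem {σ : ConvUnits₂ k 𝔾.A} (hσ : σ ∈ Z₂L k 𝔾.A) :
    𝔾.restrict σ ∈ groupZ₂ 𝔾.QuotientGrp kˣ := by
  intro q r t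
  obtain ⟨h, rfl⟩ := QuotientGroup.mk_surjective q
  obtain ⟨l, rfl⟩ := QuotientGroup.mk_surjective r
  obtain ⟨m, rfl⟩ := QuotientGroup.mk_surjective t
  rw [← QuotientGroup.mk_mul, ← QuotientGroup.mk_mul]
  simp only [restrict_mk hσ]
  ext
  have e := (isLazyCocycle_of_mem hσ).assoc (𝔾.of h) (𝔾.of l) (𝔾.of m)
  rw [of_twist (𝔾.reprOf _), of_twist (𝔾.reprOf _)] at e
  simpa [reprOf, ← TensorProduct.smul_tmul', val_value₂] using e

/-- The injectivity underlying the isomorphism: `eq_of_apply_of` for invertible cocycles. -/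
theorem eq_of_restrict {σ τ : ConvUnits₂ k 𝔾.A} (hσ : σ ∈ Z₂L k 𝔾.A) (hτ : τ ∈ Z₂L k 𝔾.A)
    (h : 𝔾.restrict σ = 𝔾.restrict τ) (hp : 𝔾.param σ.val = 𝔾.param τ.val) : σ = τ := by
  refine Units.ext (eq_of_apply_of (isLazyCocycle_of_mem hσ) (isLazyCocycle_of_mem hτ)
    (fun u v => ?_) hp)
  rw [← val_value₂, ← val_value₂, ← restrict_mk hσ, ← restrict_mk hτ, h]

theorem restrict_infl₂ {α : 𝔾.QuotientGrp → 𝔾.QuotientGrp → kˣ} : 𝔾.restrict (𝔾.infl₂ α) = α := by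
  ext q r
  change (𝔾.infl₂ α).val (𝔾.of q.out ⊗ₜ 𝔾.of r.out) = _
  rw [infl₂_apply, toQuot_of, toQuot_of, groupForm₂_single, QuotientGroup.out_eq',
    QuotientGroup.out_eq']

theorem param_infl₂ {α : 𝔾.QuotientGrp → 𝔾.QuotientGrp → kˣ} :
    𝔾.param (𝔾.infl₂ α).val = 0 := by
  rw [param, infl₂_apply, toQuot_x, TensorProduct.zero_tmul, map_zero]

/-! ### Coboundaries -/

theorem lazy_apply_x {μ : WithConv (𝔾.A →ₗ[k] k)} (hμ : IsLazy₁ μ) :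
    μ 𝔾.x = 0 := by
  have h := 𝔾.eq_zero_of_commute_coord (l := 1) 𝔾.one_lt_d (hμ.commute _)
    (𝔾.g_pow_ne_one one_ne_zero 𝔾.one_lt_d)
  simpa using h

/-- Compare the coefficients of `h x` in `μ(a₁) a₂ = μ(a₂) a₁` for `a = h x`. -/
theorem lazy_apply_mul_g {μ : WithConv (𝔾.A →ₗ[k] k)} (hμ : IsLazy₁ μ) (h : G) :
    μ (𝔾.of (h * 𝔾.g)) = μ (𝔾.of h) := by
  have e := congr($((hμ.commute (toConv (𝔾.coord h 1))).eq) (𝔾.of h * 𝔾.x ^ 1))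
  have h1 := 𝔾.coord_monomial h 1 h 𝔾.one_lt_d
  have h2 := 𝔾.coord_monomial h 1 h 𝔾.d_pos
  have h3 := 𝔾.coord_monomial h 1 (h * 𝔾.g ^ 1) 𝔾.d_pos
  simp only [and_true, if_true, zero_ne_one, and_false, if_false, pow_zero, pow_one, mul_one]
    at h1 h2 h3
  rw [convMul_of_mul_x_pow, convMul_of_mul_x_pow] at e
  simp only [Finset.sum_range_succ, Finset.range_zero, Finset.sum_empty, gauss_zero, gauss_self,
    Nat.sub_self, Nat.sub_zero, h1, h2, h3, pow_zero, pow_one, mul_one, mul_zero, zero_mul, one_mul,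
    zero_add, add_zero] at e
  exact e.symm

theorem lazy_apply_mul_g_pow {μ : WithConv (𝔾.A →ₗ[k] k)} (hμ : IsLazy₁ μ) (h : G) (n : ℕ) :
    μ (𝔾.of (h * 𝔾.g ^ n)) = μ (𝔾.of h) := by
  induction n with
  | zero => simp
  | succ n ih => rw [pow_succ, ← mul_assoc, lazy_apply_mul_g hμ, ih]

/-- On `G`, the coboundary is that of group cohomology. -/
theorem value₂_diff (μ : ConvUnits₁ k 𝔾.A) (h l : G) :
    𝔾.value₂ h l (diff μ) = 𝔾.value₁ h μ * 𝔾.value₁ l μ * (𝔾.value₁ (h * l) μ)⁻¹ := by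
  rw [diff, map_mul, map_mul, map_inv]
  refine congrArg₂ _ (congrArg₂ _ ?_ ?_) (congrArg _ ?_) <;> ext <;>
    simp [val_value₂, val_value₁, pullback_apply]

/-- The relation `∂μ(a₁, b₁) μ(a₂ b₂) = μ(a) μ(b)` at `(x, x ^ (d - 1))` says that `μ`
takes the value `μ(x) μ(x ^ (d - 1)) = 0` on the twisted product
`x ^ d + s g ^ d`, where `s` is the parameter. -/
theorem param_diff {μ : ConvUnits₁ k 𝔾.A} (hμ : μ ∈ Reg₁L k 𝔾.A) :
    𝔾.param (diff μ).val = 0 := by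
  have hσ := isLazyCocycle_of_mem (B₂L_le_Z₂L (mem_B₂L.2 ⟨μ, hμ, rfl⟩))
  have e : diff μ * Units.map (pullback (Bialgebra.mulCoalgHom k 𝔾.A)) μ =
    Units.map (pullback (pr₁ k 𝔾.A)) μ * Units.map (pullback (pr₂ k 𝔾.A)) μ := by
    rw [diff, inv_mul_cancel_right]
  have l (a b : 𝔾.A) : ((diff μ).val * pullback (Bialgebra.mulCoalgHom k 𝔾.A) μ.val) (a ⊗ₜ b) =
      μ.val (twist (diff μ).val a b) := by
    rw [((ℛ k a).tmul (ℛ k b)).convMul_apply, twist_apply (ℛ k a) (ℛ k b)]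
    simp [Finset.sum_product, pullback_apply]
  have r (a b : 𝔾.A) : (pullback (pr₁ k 𝔾.A) μ.val * pullback (pr₂ k 𝔾.A) μ.val) (a ⊗ₜ b) =
      μ.val a * μ.val b := by
    have ha := congr(μ.val $(sum_smul_counit (ℛ k a)))
    have hb := congr(μ.val $(sum_counit_smul (ℛ k b)))
    rw [((ℛ k a).tmul (ℛ k b)).convMul_apply, ← ha, ← hb]
    simp [Finset.sum_product, pullback_apply, Finset.sum_mul_sum]
    refine Finset.sum_congr rfl fun i _ => Finset.sum_congr rfl fun j _ => ?_
    ring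
  have e' := congr($(congr(($e).val)) (𝔾.x ⊗ₜ (𝔾.x ^ (𝔾.d - 1))))
  have e'' := (l _ _).symm.trans (e'.trans (r _ _))
  have hg := lazy_apply_mul_g_pow hμ.2 1 𝔾.d
  have h1 := hμ.1
  rw [one_mul, map_one, h1] at hg
  rw [lazy_apply_x hμ.2, zero_mul, x_twist_x_pow hσ, x_pow, map_add, map_smul, map_smul, map_sub,
    hg, h1] at e''
  simpa using e''

/-- A lazy cocycle is a coboundary if and only if it restricts to a coboundary on `G / ⟨g⟩` and its
parameter vanishes. -/
theorem mem_B₂L_iff {σ : ConvUnits₂ k 𝔾.A} (hσ : σ ∈ Z₂L k 𝔾.A) :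
    σ ∈ B₂L k 𝔾.A ↔ 𝔾.restrict σ ∈ groupB₂ 𝔾.QuotientGrp kˣ ∧ 𝔾.param σ.val = 0 := by
  constructor
  · intro h
    obtain ⟨μ, hμ, rfl⟩ := mem_B₂L.1 h
    refine ⟨⟨fun q => 𝔾.value₁ q.out μ, ?_⟩, param_diff hμ⟩
    ext q r
    obtain ⟨h, rfl⟩ := QuotientGroup.mk_surjective q
    obtain ⟨l, rfl⟩ := QuotientGroup.mk_surjective r
    have e (u : G) : 𝔾.value₁ (u : 𝔾.QuotientGrp).out μ = 𝔾.value₁ u μ := by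
      obtain ⟨n, hn⟩ := 𝔾.exists_out_eq u
      ext
      rw [hn, val_value₁, val_value₁, lazy_apply_mul_g_pow hμ.2]
    rw [restrict_mk hσ, value₂_diff]
    simp only [groupDiff, MonoidHom.coe_mk, OneHom.coe_mk]
    rw [← QuotientGroup.mk_mul, e, e, e]
  · rintro ⟨⟨ν, hν⟩, hp⟩
    have h1 : ν 1 = 1 := by
      have e := congr($hν ((1 : G) : 𝔾.QuotientGrp) ((1 : G) : 𝔾.QuotientGrp))
      rw [restrict_mk hσ] at e
      have e1 : 𝔾.value₂ 1 1 σ = 1 := by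
        ext
        rw [val_value₂, map_one, (hσ.1 1).1]
        simp
      rw [e1, QuotientGroup.mk_one] at e
      simpa [groupDiff] using e
    have hμ := 𝔾.infl₁_mem h1
    have hd : diff (𝔾.infl₁ ν) ∈ B₂L k 𝔾.A := mem_B₂L.2 ⟨_, hμ, rfl⟩
    have : σ = diff (𝔾.infl₁ ν) := by
      refine eq_of_restrict hσ (B₂L_le_Z₂L hd) ?_ (by rw [hp, param_diff hμ])
      rw [← hν]
      ext q r
      obtain ⟨h, rfl⟩ := QuotientGroup.mk_surjective q
      obtain ⟨l, rfl⟩ := QuotientGroup.mk_surjective r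
      have e (u : G) : 𝔾.value₁ u (𝔾.infl₁ ν) = ν u := by
        ext
        rw [val_value₁, infl₁_apply, toQuot_of, groupForm₁_single]
      rw [restrict_mk (B₂L_le_Z₂L hd), value₂_diff, e, e, e]
      rfl
    rwa [this]

/-! ### The isomorphism -/

variable (𝔾) in
/-- The restriction map `Z²_L(A(𝔾)) → Z²(G / ⟨g⟩, kˣ)`. -/
def restrictZ : Z₂L k 𝔾.A →* groupZ₂ 𝔾.QuotientGrp kˣ :=
  (𝔾.restrict.comp (Z₂L k 𝔾.A).subtype).codRestrict _ fun σ => restrict_mem σ.2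

variable (𝔾) in
/-- The map `Z²_L(A(𝔾)) → H²(G / ⟨g⟩, kˣ)`. -/
def toGroupH₂ : Z₂L k 𝔾.A →* groupH₂ 𝔾.QuotientGrp kˣ := (QuotientGroup.mk' _).comp 𝔾.restrictZ

variable (𝔾) in
/-- The parameter as a homomorphism from lazy cocycles to the additive group of `k`. -/
def paramHom : Z₂L k 𝔾.A →* Multiplicative k :=
  MonoidHom.mk' (fun σ => Multiplicative.ofAdd (𝔾.param σ.val.val)) fun σ τ =>
    congr(Multiplicative.ofAdd
      $(param_mul (isLazyCocycle_of_mem σ.2) (isLazyCocycle_of_mem τ.2)))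

theorem toGroupH₂_eq_one {σ : Z₂L k 𝔾.A} :
    𝔾.toGroupH₂ σ = 1 ↔ 𝔾.restrict σ.val ∈ groupB₂ 𝔾.QuotientGrp kˣ :=
  (QuotientGroup.eq_one_iff _).trans Subgroup.mem_subgroupOf

theorem paramHom_eq_one {σ : Z₂L k 𝔾.A} : 𝔾.paramHom σ = 1 ↔ 𝔾.param σ.val.val = 0 := Iff.rfl

/-- Each class in `H²(G / ⟨g⟩, kˣ)` comes from a lazy cocycle with parameter zero. -/
theorem exists_toGroupH₂_eq (c : groupH₂ 𝔾.QuotientGrp kˣ) :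
    ∃ σ : Z₂L k 𝔾.A, 𝔾.toGroupH₂ σ = c ∧ 𝔾.paramHom σ = 1 := by
  obtain ⟨⟨α, hα⟩, rfl⟩ := QuotientGroup.mk_surjective c
  -- Dividing by the coboundary of the constant function `α(1, 1)` normalizes `α`.
  let β : 𝔾.QuotientGrp → 𝔾.QuotientGrp → kˣ := groupDiff _ _ fun _ => α 1 1
  have hβ' : β ∈ groupB₂ 𝔾.QuotientGrp kˣ := ⟨_, rfl⟩
  have hβ (q r) : β q r = α 1 1 := by simp [β, groupDiff]
  have hβZ : β ∈ groupZ₂ 𝔾.QuotientGrp kˣ := fun q r t => by simp only [hβ]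
  have hZ := (groupZ₂ _ kˣ).mul_mem hα ((groupZ₂ _ kˣ).inv_mem hβZ)
  refine ⟨⟨_, 𝔾.infl₂_mem hZ (by simp [hβ])⟩, ?_, paramHom_eq_one.2 param_infl₂⟩
  refine QuotientGroup.eq.2 (Subgroup.mem_subgroupOf.2 ?_)
  have e : (𝔾.restrictZ ⟨_, 𝔾.infl₂_mem hZ (by simp [hβ])⟩).val = α * β⁻¹ := restrict_infl₂
  rw [Subgroup.coe_mul, Subgroup.coe_inv, e]
  simpa using hβ'

theorem nonempty_quotient_mulEquiv_prod {A B C : Type*} [Group A] [Group B] [Group C]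
    {N : Subgroup A} [N.Normal] (f : A →* B) (f' : A →* C) (hf : Function.Surjective (f.prod f'))
    (hN : ∀ a, a ∈ N ↔ f a = 1 ∧ f' a = 1) : Nonempty (A ⧸ N ≃* B × C) := by
  have hE : N = (f.prod f').ker := by
    ext a
    rw [hN, MonoidHom.mem_ker, MonoidHom.prod_apply, Prod.mk_eq_one]
  exact ⟨(QuotientGroup.quotientMulEquivOfEq hE).trans
    (QuotientGroup.quotientKerEquivOfSurjective _ hf)⟩

theorem mem_subgroupOf_iff (σ : Z₂L k 𝔾.A) : σ ∈ (B₂L k 𝔾.A).subgroupOf (Z₂L k 𝔾.A) ↔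
    𝔾.toGroupH₂ σ = 1 ∧ 𝔾.paramHom σ = 1 := by
  rw [Subgroup.mem_subgroupOf, mem_B₂L_iff σ.2, toGroupH₂_eq_one, paramHom_eq_one]

theorem nonempty_H₂L_mulEquiv_of_isTypeI (h𝔾 : 𝔾.IsTypeI) :
    Nonempty (H₂L k 𝔾.A ≃* groupH₂ 𝔾.QuotientGrp kˣ × Multiplicative k) := by
  refine nonempty_quotient_mulEquiv_prod _ _ ?_ mem_subgroupOf_iff
  rintro ⟨c, s⟩
  obtain ⟨σ, h1, h2⟩ := exists_toGroupH₂_eq c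
  let τ : Z₂L k 𝔾.A := ⟨_, Deformed.unitCocycle_mem h𝔾 s.toAdd⟩
  have t1 : 𝔾.toGroupH₂ τ = 1 := by
    rw [toGroupH₂_eq_one]
    convert (groupB₂ 𝔾.QuotientGrp kˣ).one_mem
    ext q r
    exact Deformed.cocycle_of h𝔾 _ _
  have t2 : 𝔾.paramHom τ = s := Deformed.param_cocycle h𝔾
  refine ⟨σ * τ, Prod.ext ?_ (by simp [h2, t2])⟩
  simp only [MonoidHom.prod_apply, map_mul, h1, t1]
  exact mul_one c

theorem nonempty_H₂L_mulEquiv_of_not_isTypeI (h𝔾 : ¬ 𝔾.IsTypeI) :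
    Nonempty (H₂L k 𝔾.A ≃* groupH₂ 𝔾.QuotientGrp kˣ) := by
  have hF : Function.Surjective 𝔾.toGroupH₂ := fun c =>
    (exists_toGroupH₂_eq c).imp fun _ h => h.1
  refine ⟨(QuotientGroup.quotientMulEquivOfEq ?_).trans
    (QuotientGroup.quotientKerEquivOfSurjective 𝔾.toGroupH₂ hF)⟩
  ext σ
  rw [mem_subgroupOf_iff, MonoidHom.mem_ker, and_iff_left]
  rw [paramHom_eq_one]
  by_contra hs
  exact h𝔾 (isTypeI_of_param_ne_zero (isLazyCocycle_of_mem σ.2) hs)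

end GroupDatum

end

theorem theorem7p1 {k : Type*} [Field k]
    (hk : ∀ n : ℕ, (n : k) ≠ 0 → ∃ ζ : k, IsPrimitiveRoot ζ n)
    {G : Type*} [Group G] [Finite G] (𝔾 : GroupDatum k G) :
    (𝔾.IsTypeI →
      Nonempty (LazyCohomology.H₂L k 𝔾.A ≃*
        LazyCohomology.groupH₂ (G ⧸ Subgroup.zpowers 𝔾.g) kˣ × Multiplicative k)) ∧
    (¬ 𝔾.IsTypeI →
      Nonempty (LazyCohomology.H₂L k 𝔾.A ≃*
        LazyCohomology.groupH₂ (G ⧸ Subgroup.zpowers 𝔾.g) kˣ)) :=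
  ⟨GroupDatum.nonempty_H₂L_mulEquiv_of_isTypeI,
    GroupDatum.nonempty_H₂L_mulEquiv_of_not_isTypeI⟩
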